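/- Let $n\ge 2$, let $\Omega\subset\mathbb R^n$ be a bounded Lipschitz domain and let $k>0$. All functions are real-valued, $\mathrm ds$ is the surface measure on $\partial\Omega$, and boundary values of $H^1(\Omega)$ functions are traces in $L^2(\partial\Omega)$. For $q\in L^\infty(\Omega)$ and $g\in L^2(\partial\Omega)$, a function $u\in H^1(\Omega)$ is called a weak solution of the Neumann problem $$\Delta u+k^2qu=0\ \text{ in }\Omega,\qquad \partial_\nu u=g\ \text{ on }\partial\Omega \tag{1}$$ if $\int_\Omega(\nabla u\cdot\nabla v-k^2quv)\,\mathrm dx=\int_{\partial\Omega}gv\,\mathrm ds$ for all $v\in H^1(\Omega)$. Let $\mathcal D(\Lambda)$ be the set of all $q\in L^\infty(\Omega)$ for which (1) with $g=0$ has only the solution $u=0$. Then $\mathcal D(\Lambda)$ is open in $L^\infty(\Omega)$, and for every $q\in\mathcal D(\Lambda)$ and $g\in L^2(\partial\Omega)$ problem (1) has exactly one weak solution $u$, so that the Neumann-to-Dirichlet operator $\Lambda(q):g\mapsto u|_{\partial\Omega}$ is well defined; it belongs to the space $\mathcal L(L^2(\partial\Omega))$ of bounded linear operators on $L^2(\partial\Omega)$.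 The map $\Lambda:\mathcal D(\Lambda)\subset L^\infty(\Omega)\to\mathcal L(L^2(\partial\Omega))$ is Fréchet differentiable at every $q\in\mathcal D(\Lambda)$, and for every $h\in L^\infty(\Omega)$ the derivative $\Lambda'(q)h\in\mathcal L(L^2(\partial\Omega))$ in direction $h$ is the self-adjoint operator with the quadratic form $$\int_{\partial\Omega}g\,(\Lambda'(q)h)g\,\mathrm ds=\int_\Omega k^2h\,|u|^2\,\mathrm dx\qquad\text{for all }g\in L^2(\partial\Omega),$$ where $u$ is the weak solution of (1) for this $q$ and $g$. -/

import Mathlib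

open MeasureTheory Filter Topology
open scoped ContDiff

/-- A bounded Lipschitz domain in `ℝⁿ`: a bounded, open, connected, nonempty set which near each of
its boundary points is, in suitable Cartesian coordinates `(y', t) ∈ ℝⁿ⁻¹ × ℝ`, the set
`{t > γ(y')}` of points above the graph of a Lipschitz function `γ`. -/
structure IsBoundedLipschitzDomain {n : ℕ} (Ω : Set (EuclideanSpace ℝ (Fin n))) : Prop where
  isOpen : IsOpen Ω
  isConnected : IsConnected Ω
  isBounded : Bornology.IsBounded Ω
  exists_chart : ∀ x ∈ frontier Ω, ∃ U : Set (EuclideanSpace ℝ (Fin n)), IsOpen U ∧ x ∈ U ∧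
    ∃ (e : EuclideanSpace ℝ (Fin n) ≃ₗᵢ[ℝ] WithLp 2 (EuclideanSpace ℝ (Fin (n - 1)) × ℝ))
      (L : NNReal) (γ : EuclideanSpace ℝ (Fin (n - 1)) → ℝ),
      LipschitzWith L γ ∧ ∀ y ∈ U, (y ∈ Ω ↔ γ (e y).fst < (e y).snd)

/-- Surface measure on `∂Ω`: the `(n-1)`-dimensional Hausdorff measure (normalised so as to agree
with Lebesgue measure on hyperplanes) restricted to `∂Ω`. -/
noncomputable def surfaceMeasure {n : ℕ} (Ω : Set (EuclideanSpace ℝ (Fin n))) :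
    Measure (EuclideanSpace ℝ (Fin n)) :=
  (Measure.euclideanHausdorffMeasure (n - 1)).restrict (frontier Ω)

/-- `L²(∂Ω)`, real-valued. -/
noncomputable abbrev BoundaryL2 {n : ℕ} (Ω : Set (EuclideanSpace ℝ (Fin n))) :=
  Lp ℝ 2 (surfaceMeasure Ω)

/-- `L^∞(Ω)`, real-valued. -/
noncomputable abbrev DomainLinfty {n : ℕ} (Ω : Set (EuclideanSpace ℝ (Fin n))) :=
  Lp ℝ ⊤ (volume.restrict Ω)

/-- `φ ∈ C_c^∞(Ω)`. -/
structure IsTestFunction {n : ℕ} (Ω : Set (EuclideanSpace ℝ (Fin n)))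
    (φ : EuclideanSpace ℝ (Fin n) → ℝ) : Prop where
  contDiff : ContDiff ℝ ∞ φ
  hasCompactSupport : HasCompactSupport φ
  tsupport_subset : tsupport φ ⊆ Ω

/-- `G` is the weak (distributional) gradient of `u` on `Ω`:
`∫_Ω u ∇φ dx = - ∫_Ω φ G dx` for all `φ ∈ C_c^∞(Ω)`. -/
def HasWeakGradient {n : ℕ} (Ω : Set (EuclideanSpace ℝ (Fin n)))
    (u : EuclideanSpace ℝ (Fin n) → ℝ)
    (G : EuclideanSpace ℝ (Fin n) → EuclideanSpace ℝ (Fin n)) : Prop :=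
  ∀ φ : EuclideanSpace ℝ (Fin n) → ℝ, IsTestFunction Ω φ →
    ∫ x in Ω, u x • gradient φ x = - ∫ x in Ω, φ x • G x

theorem IsTestFunction.continuous_gradient {n : ℕ} {Ω : Set (EuclideanSpace ℝ (Fin n))}
    {φ : EuclideanSpace ℝ (Fin n) → ℝ} (hφ : IsTestFunction Ω φ) :
    Continuous (gradient φ) :=
  (InnerProductSpace.toDual ℝ _).symm.continuous.comp (hφ.contDiff.continuous_fderiv (by simp))

theorem IsTestFunction.hasCompactSupport_gradient {n : ℕ} {Ω : Set (EuclideanSpace ℝ (Fin n))}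
    {φ : EuclideanSpace ℝ (Fin n) → ℝ} (hφ : IsTestFunction Ω φ) :
    HasCompactSupport (gradient φ) :=
  (hφ.hasCompactSupport.fderiv ℝ).comp_left (map_zero (InnerProductSpace.toDual ℝ _).symm)

theorem IsTestFunction.integrable_smul_gradient {n : ℕ} {Ω : Set (EuclideanSpace ℝ (Fin n))}
    {φ : EuclideanSpace ℝ (Fin n) → ℝ} (hφ : IsTestFunction Ω φ)
    (u : Lp ℝ 2 (volume.restrict Ω)) :
    Integrable (fun x => u x • gradient φ x) (volume.restrict Ω) :=
  memLp_one_iff_integrable.mp ((hφ.continuous_gradient.memLp_of_hasCompactSupport (p := 2)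
    hφ.hasCompactSupport_gradient).smul (Lp.memLp u))

theorem IsTestFunction.integrable_smul {n : ℕ} {Ω : Set (EuclideanSpace ℝ (Fin n))}
    {φ : EuclideanSpace ℝ (Fin n) → ℝ} (hφ : IsTestFunction Ω φ)
    (G : Lp (EuclideanSpace ℝ (Fin n)) 2 (volume.restrict Ω)) :
    Integrable (fun x => φ x • G x) (volume.restrict Ω) :=
  memLp_one_iff_integrable.mp ((Lp.memLp G).smul
    (hφ.contDiff.continuous.memLp_of_hasCompactSupport (p := 2) hφ.hasCompactSupport))

/-- The Sobolev space `H¹(Ω)`, as the space of pairs `(u, ∇u)` with `u ∈ L²(Ω)` whose weak gradient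
`∇u` is in `L²(Ω)ⁿ`; the norm inherited from `L²(Ω) × L²(Ω)ⁿ` is the usual one,
`‖u‖² = ‖u‖²_{L²} + ‖∇u‖²_{L²}`. -/
noncomputable def sobolevH1 {n : ℕ} (Ω : Set (EuclideanSpace ℝ (Fin n))) :
    Submodule ℝ (WithLp 2 (Lp ℝ 2 (volume.restrict Ω) ×
      Lp (EuclideanSpace ℝ (Fin n)) 2 (volume.restrict Ω))) where
  carrier := {p | HasWeakGradient Ω p.fst p.snd}
  zero_mem' := by
    intro φ hφ
    have h1 : ∫ x in Ω, ((0 : Lp ℝ 2 (volume.restrict Ω)) x) • gradient φ x = 0 := by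
      rw [integral_congr_ae (g := fun _ => 0), integral_zero]
      filter_upwards [Lp.coeFn_zero ℝ 2 (volume.restrict Ω)] with x hx
      rw [hx, Pi.zero_apply, zero_smul]
    have h2 : ∫ x in Ω, φ x •
        ((0 : Lp (EuclideanSpace ℝ (Fin n)) 2 (volume.restrict Ω)) x) = 0 := by
      rw [integral_congr_ae (g := fun _ => 0), integral_zero]
      filter_upwards [Lp.coeFn_zero (EuclideanSpace ℝ (Fin n)) 2 (volume.restrict Ω)] with x hx
      rw [hx, Pi.zero_apply, smul_zero]
    change ∫ x in Ω, ((0 : Lp ℝ 2 (volume.restrict Ω)) x) • gradient φ x = - ∫ x in Ω, φ x •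
        ((0 : Lp (EuclideanSpace ℝ (Fin n)) 2 (volume.restrict Ω)) x)
    rw [h1, h2, neg_zero]
  add_mem' := by
    intro p r hp hr φ hφ
    have h1 : ∫ x in Ω, (p.fst + r.fst) x • gradient φ x =
        ∫ x in Ω, (p.fst x • gradient φ x + r.fst x • gradient φ x) := by
      apply integral_congr_ae
      filter_upwards [Lp.coeFn_add p.fst r.fst] with x hx
      rw [hx, Pi.add_apply, add_smul]
    have h2 : ∫ x in Ω, φ x • (p.snd + r.snd) x =
        ∫ x in Ω, (φ x • p.snd x + φ x • r.snd x) := by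
      apply integral_congr_ae
      filter_upwards [Lp.coeFn_add p.snd r.snd] with x hx
      rw [hx, Pi.add_apply, smul_add]
    change ∫ x in Ω, (p.fst + r.fst) x • gradient φ x = - ∫ x in Ω, φ x • (p.snd + r.snd) x
    rw [h1, h2, integral_add (hφ.integrable_smul_gradient _) (hφ.integrable_smul_gradient _),
      integral_add (hφ.integrable_smul _) (hφ.integrable_smul _), hp φ hφ, hr φ hφ, neg_add]
  smul_mem' := by
    intro c p hp φ hφ
    have h1 : ∫ x in Ω, (c • p.fst) x • gradient φ x =
        ∫ x in Ω, c • (p.fst x • gradient φ x) := by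
      apply integral_congr_ae
      filter_upwards [Lp.coeFn_smul c p.fst] with x hx
      rw [hx, Pi.smul_apply, smul_eq_mul, mul_smul]
    have h2 : ∫ x in Ω, φ x • (c • p.snd) x = ∫ x in Ω, c • (φ x • p.snd x) := by
      apply integral_congr_ae
      filter_upwards [Lp.coeFn_smul c p.snd] with x hx
      rw [hx, Pi.smul_apply, smul_comm c]
    change ∫ x in Ω, (c • p.fst) x • gradient φ x = - ∫ x in Ω, φ x • (c • p.snd) x
    rw [h1, h2, integral_smul, integral_smul, hp φ hφ, smul_neg]

/-- The underlying `L²(Ω)` function of `u ∈ H¹(Ω)`. -/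
abbrev sobolevVal {n : ℕ} {Ω : Set (EuclideanSpace ℝ (Fin n))} (u : sobolevH1 Ω) :
    Lp ℝ 2 (volume.restrict Ω) :=
  u.1.fst

/-- The weak gradient `∇u ∈ L²(Ω)ⁿ` of `u ∈ H¹(Ω)`. -/
abbrev sobolevGrad {n : ℕ} {Ω : Set (EuclideanSpace ℝ (Fin n))} (u : sobolevH1 Ω) :
    Lp (EuclideanSpace ℝ (Fin n)) 2 (volume.restrict Ω) :=
  u.1.snd

/-- `f ∈ L²(∂Ω)` is the boundary trace of `u ∈ H¹(Ω)`: there are functions `φ_m`, smooth up to the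
boundary, with `φ_m → u` in `H¹(Ω)` and `φ_m|_{∂Ω} → f` in `L²(∂Ω)`. This is the graph of the
continuous extension of `φ ↦ φ|_{∂Ω}` to `H¹(Ω)`. -/
def IsTrace {n : ℕ} {Ω : Set (EuclideanSpace ℝ (Fin n))} (u : sobolevH1 Ω)
    (f : BoundaryL2 Ω) : Prop :=
  ∃ φ : ℕ → EuclideanSpace ℝ (Fin n) → ℝ, (∀ m, ContDiff ℝ ∞ (φ m)) ∧
    Tendsto (fun m => eLpNorm (fun x => φ m x - sobolevVal u x) 2 (volume.restrict Ω))
      atTop (𝓝 0) ∧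
    Tendsto (fun m => eLpNorm (fun x => gradient (φ m) x - sobolevGrad u x) 2
      (volume.restrict Ω)) atTop (𝓝 0) ∧
    Tendsto (fun m => eLpNorm (fun x => φ m x - f x) 2 (surfaceMeasure Ω)) atTop (𝓝 0)

/-- `u ∈ H¹(Ω)` is a weak solution of `Δu + k² q u = 0` in `Ω`, `∂_ν u = g` on `∂Ω`:
`∫_Ω (∇u · ∇v - k² q u v) dx = ∫_{∂Ω} g v ds` for all `v ∈ H¹(Ω)`, where `v` stands for its trace
in the boundary integral. -/
def IsNeumannSolution {n : ℕ} (Ω : Set (EuclideanSpace ℝ (Fin n))) (k : ℝ) (q : DomainLinfty Ω)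
    (g : BoundaryL2 Ω) (u : sobolevH1 Ω) : Prop :=
  ∀ (v : sobolevH1 Ω) (tv : BoundaryL2 Ω), IsTrace v tv →
    ∫ x in Ω, (inner ℝ (sobolevGrad u x) (sobolevGrad v x)
      - k ^ 2 * q x * sobolevVal u x * sobolevVal v x)
    = ∫ x, g x * tv x ∂(surfaceMeasure Ω)

/-- The set `L_k(Ω)` of those `q ∈ L^∞(Ω)` for which `k` is a resonance frequency, i.e. for which
the homogeneous Neumann problem has a nontrivial solution. -/
def resonanceSet {n : ℕ} (Ω : Set (EuclideanSpace ℝ (Fin n))) (k : ℝ) : Set (DomainLinfty Ω) :=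
  {q | ∃ u : sobolevH1 Ω, u ≠ 0 ∧ IsNeumannSolution Ω k q 0 u}

/-- The domain `D(Λ) = L^∞(Ω) \ L_k(Ω)` of the Neumann-to-Dirichlet map. -/
def ntdDomain {n : ℕ} (Ω : Set (EuclideanSpace ℝ (Fin n))) (k : ℝ) : Set (DomainLinfty Ω) :=
  (resonanceSet Ω k)ᶜ

/-- `T` maps every `g ∈ L²(∂Ω)` to the boundary trace of a weak solution with Neumann data `g`. -/
def IsNtD {n : ℕ} (Ω : Set (EuclideanSpace ℝ (Fin n))) (k : ℝ) (q : DomainLinfty Ω)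
    (T : BoundaryL2 Ω →L[ℝ] BoundaryL2 Ω) : Prop :=
  ∀ g : BoundaryL2 Ω, ∃ u : sobolevH1 Ω, IsNeumannSolution Ω k q g u ∧ IsTrace u (T g)

open Classical in
/-- The Neumann-to-Dirichlet map `q ↦ Λ(q) ∈ 𝓛(L²(∂Ω))`, where `Λ(q) g` is the trace of the weak
solution with Neumann data `g`; it is meant for `q ∈ D(Λ)` (and takes the junk value `0` where
no such operator exists). -/
noncomputable def ntd {n : ℕ} (Ω : Set (EuclideanSpace ℝ (Fin n))) (k : ℝ) (q : DomainLinfty Ω) :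
    BoundaryL2 Ω →L[ℝ] BoundaryL2 Ω :=
  if h : ∃ T, IsNtD Ω k q T then h.choose else 0

/-! The weak problem is a single operator equation on the Hilbert space H¹(Ω). Let J be the
embedding H¹(Ω) → L²(Ω), τ the trace operator and M(q) multiplication by q. Since ∫∇u·∇v is the H¹
inner product minus the L² one, the weak formulation says A(q)u = τ*g with A(q) = 1 - J*J - k²
J*M(q)J, a self-adjoint operator that is affine and continuous in q (`isNeumannSolution_iff`,
`inner_formOp`).

Rellich's theorem makes A(q) a compact perturbation of the identity, so injectivity already gives
invertibility (`isUnit_one_sub_of_injective`). Hence D(Λ) is the set where A(q) is a unit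
(`mem_ntdDomain_iff`), which is open because units are open, and there Λ(q) = τ A(q)⁻¹ τ*
(`ntd_eq`). Differentiating the inverse gives Λ'(q)h = k² τ A⁻¹ J*M(h)J A⁻¹ τ*. As A⁻¹ is
self-adjoint, this operator is self-adjoint, and its quadratic form at g is k² ⟨M(h)Ju, Ju⟩ with u =
A⁻¹τ*g (`inner_fderiv_comp_formSolution`).

What remains is Sobolev theory on a Lipschitz domain, derived from the graph charts. Near a boundary
point there is one direction ν pointing into Ω. Integrating φ² along segments in direction ν yields
the trace inequality (`exists_trace_inequality`) and shows that thin boundary layers carry little L²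
mass (`exists_compact_lintegral_le`). Mollifying with a kernel supported in a cone around -ν shows
that smooth functions are dense (`exists_contDiff_eLpNorm_sub_le`); together with the trace
inequality this constructs τ. Rellich's theorem (`tendsto_sobolevEmbedding`) follows by neglecting
the boundary layer and comparing φ on the remaining compact set with its averages over small balls,
which vanish in the limit under weak convergence to 0. -/

/-! ### Depth functions near the boundary -/

/-- Local description of a domain near a boundary point by a signed depth function `d`,
Lipschitz and increasing with unit speed in the direction `ν`. -/
structure IsDepthChart {E : Type*} [NormedAddCommGroup E] [InnerProductSpace ℝ E]
    (Ω : Set E) (U : Set E) (ν : E) (M : NNReal) (d : E → ℝ) : Prop where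
  isOpen : IsOpen U
  norm_dir : ‖ν‖ = 1
  lipschitz : LipschitzWith M d
  depth_add : ∀ (y : E) (s : ℝ), d (y + s • ν) = d y + s
  mem_iff : ∀ y ∈ U, (y ∈ Ω ↔ 0 < d y)

namespace IsDepthChart

variable {E : Type*} [NormedAddCommGroup E] [InnerProductSpace ℝ E]
  {Ω U : Set E} {ν : E} {M : NNReal} {d : E → ℝ}

/-- A positive depth would put `y` in the open set `Ω`, which misses its frontier; a negative depth
would keep a whole neighbourhood of `y` out of `Ω`. -/
theorem depth_eq_zero (h : IsDepthChart Ω U ν M d) (hΩ : IsOpen Ω) {y : E} (hyU : y ∈ U)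
    (hy : y ∈ frontier Ω) : d y = 0 := by
  have hyn : y ∉ Ω := fun hy' => by
    rw [hΩ.frontier_eq] at hy
    exact hy.2 hy'
  apply le_antisymm (not_lt.mp fun h' => hyn ((h.mem_iff y hyU).mpr h'))
  by_contra! hneg
  have hN : U ∩ d ⁻¹' Set.Iio 0 ∈ 𝓝 y :=
    inter_mem (h.isOpen.mem_nhds hyU) (h.lipschitz.continuous.continuousAt (Iio_mem_nhds hneg))
  obtain ⟨z, ⟨hzU, hz⟩, hzΩ⟩ := mem_closure_iff_nhds.mp (frontier_subset_closure hy) _ hN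
  exact lt_asymm hz ((h.mem_iff z hzU).mp hzΩ)

/-- Moving by `ε • ν` raises the depth by `ε`, and a further displacement of length `c * ε` lowers
it by at most `M * c * ε ≤ ε / 2`. The factor 3 in the hypothesis leaves room for both displacements
inside `U`. -/
theorem exists_cone (h : IsDepthChart Ω U ν M d) {x : E} {r : ℝ} (hr : 0 < r)
    (hU : Metric.ball x (3 * r) ⊆ U) :
    ∃ c > 0, ∀ y ∈ Ω ∩ Metric.ball x r, ∀ ε, 0 < ε → ε ≤ r →
      Metric.closedBall (y + ε • ν) (c * ε) ⊆ Ω := by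
  have hM : (0 : ℝ) ≤ M := M.2
  refine ⟨1 / (2 * (M + 1)), by positivity, fun y hy ε hε hεr z hz => ?_⟩
  have hc1 : 1 / (2 * ((M : ℝ) + 1)) ≤ 1 / 2 := by
    rw [div_le_div_iff₀ (by positivity) (by norm_num)]
    linarith
  have hc2 : (M : ℝ) * (1 / (2 * ((M : ℝ) + 1))) ≤ 1 / 2 := by
    rw [mul_one_div, div_le_div_iff₀ (by positivity) (by norm_num)]
    linarith
  have hyU : y ∈ U := hU (Metric.ball_subset_ball (by linarith) hy.2)
  have hdy : 0 < d y := (h.mem_iff y hyU).mp hy.1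
  have hdist : dist z (y + ε • ν) ≤ 1 / (2 * (M + 1)) * ε := hz
  have hy1 : dist (y + ε • ν) y = ε := by
    rw [dist_eq_norm, add_sub_cancel_left, norm_smul, h.norm_dir, mul_one,
      Real.norm_of_nonneg hε.le]
  have hzU : z ∈ U := by
    apply hU
    have h1 : dist y x < r := hy.2
    have h2 := dist_triangle z (y + ε • ν) x
    have h3 := dist_triangle (y + ε • ν) y x
    have h4 : 1 / (2 * ((M : ℝ) + 1)) * ε ≤ 1 / 2 * ε := by gcongr
    rw [Metric.mem_ball]
    linarith
  rw [h.mem_iff z hzU]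
  have h1 := h.lipschitz.dist_le_mul z (y + ε • ν)
  rw [Real.dist_eq, h.depth_add] at h1
  have h2 : (M : ℝ) * dist z (y + ε • ν) ≤ 1 / 2 * ε := by
    calc (M : ℝ) * dist z (y + ε • ν) ≤ M * (1 / (2 * (M + 1)) * ε) := by gcongr
      _ = (M * (1 / (2 * (M + 1)))) * ε := by ring
      _ ≤ 1 / 2 * ε := by gcongr
  have := (abs_le.mp (h1.trans h2)).1
  linarith

variable [FiniteDimensional ℝ E] [MeasurableSpace E] [BorelSpace E]

/-- Tonelli together with the translation `z = y + s • ν`. For fixed `z` the admissible `s` satisfy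
`0 < d z - s < η`, hence lie in an interval of length `η`; this is where the small factor comes
from. -/
theorem lintegral_layer_le (h : IsDepthChart Ω U ν M d) (hΩ : IsOpen Ω) {x : E} {r : ℝ}
    (hU : Metric.ball x (2 * r) ⊆ U) {η : ℝ} {F : E → ENNReal} (hF : Measurable F) :
    ∫⁻ y in {y ∈ Metric.ball x r | d y < η} ∩ Ω, ∫⁻ s in Set.Ioc 0 r, F (y + s • ν) ≤
      ENNReal.ofReal η * ∫⁻ y in Ω, F y := by
  set S : Set E := {y ∈ Metric.ball x r | d y < η} ∩ Ω with hS
  have hd : Measurable d := h.lipschitz.continuous.measurable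
  have hSm : MeasurableSet S :=
    ((Metric.isOpen_ball.measurableSet).inter (hd measurableSet_Iio)).inter hΩ.measurableSet
  have key : ∀ z, ∀ s ∈ Set.Ioc 0 r, z - s • ν ∈ S → z ∈ Ω ∧ s ∈ Set.Ioo (d z - η) (d z) := by
    intro z s hs hz
    obtain ⟨⟨hzb, hzd⟩, hzΩ⟩ := hz
    have h1 : 0 < d (z - s • ν) :=
      (h.mem_iff _ (hU (Metric.ball_subset_ball (by linarith [hs.1, hs.2]) hzb))).mp hzΩ
    have h2 : d z = d (z - s • ν) + s := by rw [← h.depth_add, sub_add_cancel]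
    refine ⟨?_, ?_, ?_⟩
    · rw [h.mem_iff z]
      · linarith [hs.1]
      · apply hU
        rw [Metric.mem_ball]
        have h3 : dist z (z - s • ν) = s := by
          rw [dist_eq_norm, sub_sub_cancel, norm_smul, h.norm_dir, mul_one,
            Real.norm_of_nonneg hs.1.le]
        have h4 := dist_triangle z (z - s • ν) x
        have h5 : dist (z - s • ν) x < r := hzb
        linarith [hs.2]
    · linarith
    · linarith
  calc ∫⁻ y in S, ∫⁻ s in Set.Ioc 0 r, F (y + s • ν)
      = ∫⁻ s in Set.Ioc 0 r, ∫⁻ y in S, F (y + s • ν) := by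
        apply lintegral_lintegral_swap
        apply Measurable.aemeasurable
        apply hF.comp
        fun_prop
    _ = ∫⁻ s in Set.Ioc 0 r, ∫⁻ z, S.indicator (fun _ => F z) (z - s • ν) := by
        congr 1 with s
        rw [← lintegral_indicator hSm, ← lintegral_sub_right_eq_self _ (s • ν)]
        congr 1 with z
        by_cases hz : z - s • ν ∈ S <;> simp [hz]
    _ = ∫⁻ z, ∫⁻ s in Set.Ioc 0 r, S.indicator (fun _ => F z) (z - s • ν) := by
        apply lintegral_lintegral_swap
        apply Measurable.aemeasurable
        have : (Function.uncurry fun (s : ℝ) (z : E) => S.indicator (fun _ => F z) (z - s • ν)) =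
            ((fun p : ℝ × E => p.2 - p.1 • ν) ⁻¹' S).indicator (fun p => F p.2) := by
          ext p
          rfl
        rw [this]
        exact (hF.comp measurable_snd).indicator ((by fun_prop : Measurable _) hSm)
    _ ≤ ∫⁻ z, Ω.indicator F z * ENNReal.ofReal η := by
        apply lintegral_mono
        intro z
        calc ∫⁻ s in Set.Ioc 0 r, S.indicator (fun _ => F z) (z - s • ν)
            ≤ ∫⁻ s in Set.Ioc 0 r, (Set.Ioo (d z - η) (d z)).indicator
                (fun _ => Ω.indicator F z) s := by
              apply setLIntegral_mono' measurableSet_Ioc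
              intro s hs
              by_cases hz : z - s • ν ∈ S
              · obtain ⟨h1, h2⟩ := key z s hs hz
                simp only [Set.indicator_of_mem, h1, h2, hz, le_refl]
              · simp [hz]
          _ ≤ ∫⁻ s, (Set.Ioo (d z - η) (d z)).indicator (fun _ => Ω.indicator F z) s :=
              setLIntegral_le_lintegral _ _
          _ = _ := by
              rw [lintegral_indicator measurableSet_Ioo, setLIntegral_const, Real.volume_Ioo,
                sub_sub_cancel]
    _ = ENNReal.ofReal η * ∫⁻ y in Ω, F y := by
        rw [lintegral_mul_const _ (hF.indicator hΩ.measurableSet),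
          lintegral_indicator hΩ.measurableSet, mul_comm]

end IsDepthChart

/-! ### Graph coordinates and surface measure -/

section Graph

variable {n : ℕ}

/-- The graph parametrisation `y' ↦ e⁻¹ (y', γ y')`. -/
noncomputable def graphMap
    (e : EuclideanSpace ℝ (Fin n) ≃ₗᵢ[ℝ] WithLp 2 (EuclideanSpace ℝ (Fin (n - 1)) × ℝ))
    (γ : EuclideanSpace ℝ (Fin (n - 1)) → ℝ) (y : EuclideanSpace ℝ (Fin (n - 1))) :
    EuclideanSpace ℝ (Fin n) :=
  e.symm (WithLp.toLp 2 (y, γ y))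

variable {e : EuclideanSpace ℝ (Fin n) ≃ₗᵢ[ℝ] WithLp 2 (EuclideanSpace ℝ (Fin (n - 1)) × ℝ)}
  {γ : EuclideanSpace ℝ (Fin (n - 1)) → ℝ} {L : NNReal}

theorem exists_lipschitzWith_graphMap (hγ : LipschitzWith L γ) :
    ∃ K : NNReal, LipschitzWith K (graphMap e γ) := by
  obtain ⟨K, hK⟩ : ∃ K : NNReal, LipschitzWith K
      (WithLp.toLp 2 : EuclideanSpace ℝ (Fin (n - 1)) × ℝ → _) :=
    ⟨_, WithLp.prod_lipschitzWith_toLp 2 _ _⟩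
  exact ⟨_, e.symm.lipschitz.comp (hK.comp (LipschitzWith.id.prodMk hγ))⟩

theorem isDepthChart_of_graph {Ω U : Set (EuclideanSpace ℝ (Fin n))} (hU : IsOpen U)
    (hγ : LipschitzWith L γ) (h : ∀ y ∈ U, (y ∈ Ω ↔ γ (e y).fst < (e y).snd)) :
    ∃ M, IsDepthChart Ω U (e.symm (WithLp.toLp 2 (0, 1))) M
      (fun y => (e y).snd - γ (e y).fst) := by
  have h1 : LipschitzWith 1 (fun y => (e y).fst) :=
    LipschitzWith.of_dist_le_mul fun x y => by
      rw [NNReal.coe_one, one_mul, ← e.dist_map x y, dist_eq_norm, dist_eq_norm,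
        ← WithLp.sub_fst]
      exact WithLp.norm_fst_le _ _
  have h2 : LipschitzWith 1 (fun y => (e y).snd) :=
    LipschitzWith.of_dist_le_mul fun x y => by
      rw [NNReal.coe_one, one_mul, ← e.dist_map x y, dist_eq_norm, dist_eq_norm,
        ← WithLp.sub_snd]
      exact WithLp.norm_snd_le _ _
  refine ⟨_, hU, ?_, h2.sub (hγ.comp h1), fun y s => ?_, fun y hy => ?_⟩
  · rw [e.symm.norm_map]
    simp
  · simp only [map_add, map_smul, e.apply_symm_apply, WithLp.add_fst, WithLp.add_snd,
      WithLp.smul_fst, WithLp.smul_snd, smul_eq_mul]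
    change (e y).snd + s * 1 - γ ((e y).fst + s • 0) = _
    rw [smul_zero, add_zero]
    ring
  · rw [h y hy, sub_pos]

/-- A `K`-Lipschitz map multiplies (n-1)-dimensional Hausdorff measure by at most `K ^ (n - 1)`, and
on the parameter space the normalised Hausdorff measure is Lebesgue measure. Only this upper bound
is needed, so no area formula enters. -/
theorem exists_restrict_hausdorff_le (hγ : LipschitzWith L γ) {S : Set (EuclideanSpace ℝ (Fin n))}
    (hS : S ⊆ Set.range (graphMap e γ)) :
    ∃ K : NNReal, (Measure.euclideanHausdorffMeasure (n - 1)).restrict S ≤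
      K • Measure.map (graphMap e γ) volume := by
  obtain ⟨K, hK⟩ := exists_lipschitzWith_graphMap (e := e) hγ
  refine ⟨K ^ (n - 1), Measure.le_iff.mpr fun B hB => ?_⟩
  rw [Measure.restrict_apply hB, Measure.smul_apply,
    Measure.map_apply hK.continuous.measurable hB]
  have hsub : B ∩ S ⊆ graphMap e γ '' (graphMap e γ ⁻¹' B) := by
    rintro y ⟨hyB, hyS⟩
    obtain ⟨z, rfl⟩ := hS hyS
    exact ⟨z, hyB, rfl⟩
  refine (measure_mono hsub).trans ?_
  rw [← EuclideanSpace.euclideanHausdorffMeasure_eq_volume (n - 1),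
    Measure.euclideanHausdorffMeasure_def, Measure.euclideanHausdorffMeasure_def,
    Measure.smul_apply, Measure.smul_apply, smul_comm]
  gcongr
  have := hK.hausdorffMeasure_image_le (d := ((n - 1 : ℕ) : ℝ)) (by positivity)
    (graphMap e γ ⁻¹' B)
  rw [ENNReal.rpow_natCast] at this
  rw [ENNReal.smul_def, smul_eq_mul, ENNReal.coe_pow]
  exact this

/-- On each vertical line the graph height is a translation, which leaves Lebesgue measure
unchanged. What is left is a linear isomorphism, whose image of Lebesgue measure is a Haar measure
and so a constant multiple of `volume`; the value of the constant is irrelevant. -/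
theorem exists_lintegral_graph_fiber_le :
    ∃ c : NNReal, ∀ F : EuclideanSpace ℝ (Fin n) → ENNReal, Measurable F →
      ∫⁻ y, ∫⁻ s : ℝ, F (graphMap e γ y + s • e.symm (WithLp.toLp 2 (0, 1))) ≤ c * ∫⁻ x, F x := by
  let T : (EuclideanSpace ℝ (Fin (n - 1)) × ℝ) ≃L[ℝ] EuclideanSpace ℝ (Fin n) :=
    (WithLp.prodContinuousLinearEquiv 2 ℝ _ _).symm.trans e.symm.toContinuousLinearEquiv
  have hT : ∀ p, T p = e.symm (WithLp.toLp 2 p) := fun p => rfl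
  have := T.isAddHaarMeasure_map (volume.prod volume)
  refine ⟨(Measure.map T (volume.prod volume)).addHaarScalarFactor volume, fun F hF => ?_⟩
  have hFT : Measurable fun p => F (T p) := hF.comp T.continuous.measurable
  calc ∫⁻ y, ∫⁻ s : ℝ, F (graphMap e γ y + s • e.symm (WithLp.toLp 2 (0, 1)))
      = ∫⁻ y, ∫⁻ s, F (T (y, s + γ y)) := by
        congr 1 with y
        congr 1 with s
        rw [hT, graphMap, ← map_smul, ← map_add]
        congr 2
        rw [← WithLp.toLp_smul, ← WithLp.toLp_add]
        congr 1
        apply Prod.ext <;> simp [add_comm]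
    _ = ∫⁻ y, ∫⁻ s, F (T (y, s)) := by
        congr 1 with y
        exact lintegral_add_right_eq_self (fun s => F (T (y, s))) (γ y)
    _ = ∫⁻ p, F (T p) ∂(volume.prod volume) := (lintegral_prod _ hFT.aemeasurable).symm
    _ = ∫⁻ x, F x ∂(Measure.map T (volume.prod volume)) :=
        (lintegral_map hF T.continuous.measurable).symm
    _ = _ := by
        conv_lhs =>
          rw [Measure.isAddLeftInvariant_eq_smul (Measure.map T (volume.prod volume)) volume]
        rw [lintegral_smul_measure, ENNReal.smul_def, smul_eq_mul]
    _ ≤ _ := le_rfl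

/-- The surface measure is dominated by the image of Lebesgue measure under the graph map. Segments
of length `r` from the graph in direction ν stay in `Ω`, so `F` may be replaced by its restriction
to `Ω` before integrating over all vertical lines. -/
theorem exists_lintegral_surface_le {Ω U : Set (EuclideanSpace ℝ (Fin n))} (hΩ : IsOpen Ω)
    (hU : IsOpen U) (hγ : LipschitzWith L γ)
    (h : ∀ y ∈ U, (y ∈ Ω ↔ γ (e y).fst < (e y).snd)) {x : EuclideanSpace ℝ (Fin n)} {r : ℝ}
    (hr : Metric.ball x (2 * r) ⊆ U) :
    ∃ C : NNReal, ∀ F : EuclideanSpace ℝ (Fin n) → ENNReal, Measurable F →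
      ∫⁻ y in Metric.ball x r, (∫⁻ s in Set.Ioc 0 r,
        F (y + s • e.symm (WithLp.toLp 2 (0, 1)))) ∂(surfaceMeasure Ω) ≤ C * ∫⁻ y in Ω, F y := by
  obtain ⟨M, hd⟩ := isDepthChart_of_graph hU hγ h
  set ν : EuclideanSpace ℝ (Fin n) := e.symm (WithLp.toLp 2 (0, 1)) with hν
  have hrU : ∀ y ∈ Metric.ball x r, ∀ s, 0 ≤ s → s ≤ r → y + s • ν ∈ U := by
    intro y hy s hs hsr
    apply hr
    have h1 : dist (y + s • ν) y = s := by
      rw [dist_eq_norm, add_sub_cancel_left, norm_smul, hd.norm_dir, mul_one,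
        Real.norm_of_nonneg hs]
    have h2 := dist_triangle (y + s • ν) y x
    have h3 : dist y x < r := hy
    rw [Metric.mem_ball]
    linarith
  have hS : Metric.ball x r ∩ frontier Ω ⊆ Set.range (graphMap e γ) := by
    rintro y ⟨hy, hyf⟩
    have hyU : y ∈ U := by
      have hr0 : 0 ≤ r := dist_nonneg.trans (Metric.mem_ball.mp hy).le
      simpa using hrU y hy 0 le_rfl hr0
    have hy0 := hd.depth_eq_zero hΩ hyU hyf
    refine ⟨(e y).fst, ?_⟩
    rw [graphMap, LinearIsometryEquiv.symm_apply_eq, ← sub_eq_zero.mp hy0]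
    rfl
  obtain ⟨K, hK⟩ := exists_restrict_hausdorff_le hγ hS
  obtain ⟨c, hc⟩ := exists_lintegral_graph_fiber_le (e := e) (γ := γ)
  have hΓ : Measurable (graphMap e γ) := by
    obtain ⟨K', hK'⟩ := exists_lipschitzWith_graphMap (e := e) hγ
    exact hK'.continuous.measurable
  refine ⟨K * c, fun F hF => ?_⟩
  set f : EuclideanSpace ℝ (Fin n) → ENNReal := fun y =>
    ∫⁻ s in Set.Ioc 0 r, F (y + s • ν) with hf
  have hfm : Measurable f := by
    apply Measurable.lintegral_prod_right
    apply hF.comp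
    fun_prop
  calc ∫⁻ y in Metric.ball x r, f y ∂(surfaceMeasure Ω)
      = ∫⁻ y in Metric.ball x r, (Metric.ball x r).indicator f y ∂(surfaceMeasure Ω) := by
        apply setLIntegral_congr_fun measurableSet_ball
        intro y hy
        simp [Set.indicator_of_mem hy]
    _ = ∫⁻ y, (Metric.ball x r).indicator f y
          ∂((Measure.euclideanHausdorffMeasure (n - 1)).restrict
            (Metric.ball x r ∩ frontier Ω)) := by
        rw [surfaceMeasure, Measure.restrict_restrict measurableSet_ball]
    _ ≤ ∫⁻ y, (Metric.ball x r).indicator f y ∂(K • Measure.map (graphMap e γ) volume) :=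
        lintegral_mono' hK le_rfl
    _ = K * ∫⁻ y, (Metric.ball x r).indicator f (graphMap e γ y) := by
        rw [lintegral_smul_measure, lintegral_map (hfm.indicator measurableSet_ball) hΓ,
          ENNReal.smul_def, smul_eq_mul]
    _ ≤ K * ∫⁻ y, ∫⁻ s : ℝ, Ω.indicator F (graphMap e γ y + s • ν) := by
        gcongr with y
        by_cases hy : graphMap e γ y ∈ Metric.ball x r
        · simp only [Set.indicator_of_mem hy, hf]
          rw [← lintegral_indicator measurableSet_Ioc]
          apply lintegral_mono
          intro s
          by_cases hs : s ∈ Set.Ioc 0 r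
          · have hmem : graphMap e γ y + s • ν ∈ Ω := by
              rw [hd.mem_iff _ (hrU _ hy s hs.1.le hs.2), hd.depth_add]
              simpa [graphMap] using hs.1
            simp only [Set.indicator_of_mem hs, Set.indicator_of_mem hmem, le_refl]
          · simp [Set.indicator_of_notMem hs]
        · simp [Set.indicator_of_notMem hy]
    _ ≤ K * (c * ∫⁻ y, Ω.indicator F y) := by
        gcongr
        exact hc _ (hF.indicator hΩ.measurableSet)
    _ = _ := by
        rw [lintegral_indicator hΩ.measurableSet, ENNReal.coe_mul, mul_assoc]

end Graph

/-- Near each boundary point a bounded Lipschitz domain satisfies a cone condition, and integrals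
along short segments starting on the boundary or in a thin boundary layer are controlled by
integrals over the domain. -/
theorem IsBoundedLipschitzDomain.exists_nhds_segment_bounds {n : ℕ}
    {Ω : Set (EuclideanSpace ℝ (Fin n))} (hΩ : IsBoundedLipschitzDomain Ω)
    {x : EuclideanSpace ℝ (Fin n)} (hx : x ∈ frontier Ω) :
    ∃ r > 0, ∃ ν : EuclideanSpace ℝ (Fin n), ‖ν‖ = 1 ∧
      (∃ c > 0, ∀ y ∈ Ω ∩ Metric.ball x r, ∀ ε, 0 < ε → ε ≤ r →
        Metric.closedBall (y + ε • ν) (c * ε) ⊆ Ω) ∧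
      (∃ C : NNReal, ∀ F : EuclideanSpace ℝ (Fin n) → ENNReal, Measurable F →
        ∫⁻ y in Metric.ball x r, (∫⁻ s in Set.Ioc 0 r, F (y + s • ν)) ∂(surfaceMeasure Ω) ≤
          C * ∫⁻ y in Ω, F y) ∧
      ∀ η > 0, ∃ N : Set (EuclideanSpace ℝ (Fin n)), IsOpen N ∧
        frontier Ω ∩ Metric.ball x r ⊆ N ∧
        ∀ F : EuclideanSpace ℝ (Fin n) → ENNReal, Measurable F →
          ∫⁻ y in N ∩ Ω, ∫⁻ s in Set.Ioc 0 r, F (y + s • ν) ≤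
            ENNReal.ofReal η * ∫⁻ y in Ω, F y := by
  obtain ⟨U, hU, hxU, e, L, γ, hγ, h⟩ := hΩ.exists_chart x hx
  obtain ⟨M, hd⟩ := isDepthChart_of_graph hU hγ h
  obtain ⟨R, hR, hRU⟩ := Metric.isOpen_iff.mp hU x hxU
  -- The radius `R / 3` meets both size requirements: `3 * r` for the cone and `2 * r` for the
  -- segment estimates.
  have h3 : Metric.ball x (3 * (R / 3)) ⊆ U := by convert hRU using 2; ring
  have h2 : Metric.ball x (2 * (R / 3)) ⊆ U :=
    (Metric.ball_subset_ball (by linarith)).trans h3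
  refine ⟨R / 3, by positivity, _, hd.norm_dir, hd.exists_cone (by positivity) h3,
    exists_lintegral_surface_le hΩ.isOpen hU hγ h h2, fun η hη => ⟨_, ?_, ?_,
      fun F hF => hd.lintegral_layer_le hΩ.isOpen h2 hF⟩⟩
  · exact Metric.isOpen_ball.inter (hd.lipschitz.continuous.isOpen_preimage _ isOpen_Iio)
  · rintro y ⟨hyf, hy⟩
    refine ⟨hy, ?_⟩
    rw [hd.depth_eq_zero hΩ.isOpen (h2 (Metric.ball_subset_ball (by linarith) hy)) hyf]
    exact hη

theorem setLIntegral_biUnion_finset_le {α ι : Type*} [MeasurableSpace α] (μ : Measure α)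
    (t : Finset ι) (s : ι → Set α) (f : α → ENNReal) :
    ∫⁻ a in ⋃ i ∈ t, s i, f a ∂μ ≤ ∑ i ∈ t, ∫⁻ a in s i, f a ∂μ := by
  classical
  induction t using Finset.induction_on with
  | empty => simp
  | insert i t hi ih =>
    rw [Finset.set_biUnion_insert, Finset.sum_insert hi]
    exact (lintegral_union_le _ _ _).trans (by gcongr)

/-! ### Pointwise bounds by integration along segments -/

section Segment

variable {E : Type*} [NormedAddCommGroup E] [InnerProductSpace ℝ E] [CompleteSpace E]

theorem continuous_gradient_of_contDiff {φ : E → ℝ} (hφ : ContDiff ℝ ∞ φ) :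
    Continuous (gradient φ) :=
  (InnerProductSpace.toDual ℝ _).symm.continuous.comp (hφ.continuous_fderiv (by simp))

theorem hasDerivAt_comp_line {φ : E → ℝ} (hφ : ContDiff ℝ ∞ φ) (y v : E) (s : ℝ) :
    HasDerivAt (fun s : ℝ => φ (y + s • v)) (inner ℝ (gradient φ (y + s • v)) v) s := by
  have h1 : HasFDerivAt φ (fderiv ℝ φ (y + s • v)) (y + s • v) :=
    (hφ.differentiable (by simp)).differentiableAt.hasFDerivAt
  have h2 : HasDerivAt (fun s : ℝ => y + s • v) v s := by
    simpa using ((hasDerivAt_id s).smul_const v).const_add y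
  have h3 := h1.comp_hasDerivAt s h2
  rwa [gradient, InnerProductSpace.toDual_symm_apply]

/-- By the fundamental theorem of calculus φ(y)² equals φ(y + sν)² minus the integral of 2φ ∂_νφ,
and |2φ ∂_νφ| ≤ φ² + |∇φ|². Integrating the resulting bound over `s` in (0, r) gives the factor `1 +
r`. -/
theorem sq_le_integral_segment {φ : E → ℝ} (hφ : ContDiff ℝ ∞ φ) {ν : E} (hν : ‖ν‖ = 1) {r : ℝ}
    (hr : 0 < r) (y : E) :
    r * φ y ^ 2 ≤ (1 + r) *
      ∫ s in (0 : ℝ)..r, (φ (y + s • ν) ^ 2 + ‖gradient φ (y + s • ν)‖ ^ 2) := by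
  have hc : Continuous φ := hφ.continuous
  have hgc := continuous_gradient_of_contDiff hφ
  set G : ℝ → ℝ := fun s => φ (y + s • ν) ^ 2 + ‖gradient φ (y + s • ν)‖ ^ 2 with hG
  have hGc : Continuous G := by fun_prop
  have hgd : ∀ s, HasDerivAt (fun s : ℝ => φ (y + s • ν) ^ 2)
      (2 * φ (y + s • ν) * inner ℝ (gradient φ (y + s • ν)) ν) s := fun s => by
    have := (hasDerivAt_comp_line hφ y ν s).fun_pow 2
    simpa only [Nat.cast_ofNat, Nat.add_one_sub_one, pow_one] using this
  have hle : ∀ s ∈ Set.Icc (0 : ℝ) r, φ y ^ 2 ≤ φ (y + s • ν) ^ 2 + ∫ t in (0 : ℝ)..r, G t := by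
    intro s hs
    have hint := intervalIntegral.integral_eq_sub_of_hasDerivAt (a := 0) (b := s)
      (fun t _ => hgd t) (Continuous.intervalIntegrable (by fun_prop) _ _)
    simp only [zero_smul, add_zero] at hint
    have h1 : -∫ t in (0 : ℝ)..s, 2 * φ (y + t • ν) * inner ℝ (gradient φ (y + t • ν)) ν ≤
        ∫ t in (0 : ℝ)..s, G t := by
      rw [← intervalIntegral.integral_neg]
      apply intervalIntegral.integral_mono_on hs.1
        (Continuous.intervalIntegrable (by fun_prop) _ _) (hGc.intervalIntegrable _ _)
      intro t _
      have h2 := abs_real_inner_le_norm (gradient φ (y + t • ν)) ν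
      rw [hν, mul_one] at h2
      have h3 := sq_le_sq' (by linarith [neg_le_of_abs_le h2]) (le_of_abs_le h2)
      rw [hG]
      nlinarith [sq_nonneg (φ (y + t • ν) + inner ℝ (gradient φ (y + t • ν)) ν)]
    have h4 : ∫ t in (0 : ℝ)..s, G t ≤ ∫ t in (0 : ℝ)..r, G t :=
      intervalIntegral.integral_mono_interval le_rfl hs.1 hs.2
        (ae_of_all _ fun t => by positivity) (hGc.intervalIntegrable _ _)
    linarith
  have h5 : ∫ _ in (0 : ℝ)..r, φ y ^ 2 ≤
      ∫ s in (0 : ℝ)..r, (φ (y + s • ν) ^ 2 + ∫ t in (0 : ℝ)..r, G t) :=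
    intervalIntegral.integral_mono_on hr.le (Continuous.intervalIntegrable (by fun_prop) _ _)
      (Continuous.intervalIntegrable (by fun_prop) _ _) hle
  rw [intervalIntegral.integral_add (Continuous.intervalIntegrable (by fun_prop) _ _)
    (Continuous.intervalIntegrable (by fun_prop) _ _), intervalIntegral.integral_const,
    intervalIntegral.integral_const, sub_zero, smul_eq_mul, smul_eq_mul] at h5
  have h6 : ∫ s in (0 : ℝ)..r, φ (y + s • ν) ^ 2 ≤ ∫ t in (0 : ℝ)..r, G t := by
    apply intervalIntegral.integral_mono_on hr.le
      (Continuous.intervalIntegrable (by fun_prop) _ _) (hGc.intervalIntegrable _ _)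
    intro t _
    rw [hG]
    nlinarith [sq_nonneg ‖gradient φ (y + t • ν)‖]
  linarith

/-- The density `|φ|² + |∇φ|²` of the `H¹` energy. -/
noncomputable def energyDensity (φ : E → ℝ) (x : E) : ENNReal :=
  ‖φ x‖ₑ ^ 2 + ‖gradient φ x‖ₑ ^ 2

theorem energyDensity_eq_ofReal (φ : E → ℝ) (x : E) :
    energyDensity φ x = ENNReal.ofReal (φ x ^ 2 + ‖gradient φ x‖ ^ 2) := by
  rw [energyDensity, ENNReal.ofReal_add (by positivity) (by positivity),
    ENNReal.ofReal_pow (norm_nonneg _), ofReal_norm, ← sq_abs, ENNReal.ofReal_pow (abs_nonneg _),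
    ← Real.enorm_eq_ofReal_abs]

theorem continuous_energyDensity {φ : E → ℝ} (hφ : ContDiff ℝ ∞ φ) :
    Continuous (energyDensity φ) := by
  have h1 : Continuous φ := hφ.continuous
  have h2 := continuous_gradient_of_contDiff hφ
  have : energyDensity φ = fun x => ENNReal.ofReal (φ x ^ 2 + ‖gradient φ x‖ ^ 2) :=
    funext (energyDensity_eq_ofReal φ)
  rw [this]
  exact ENNReal.continuous_ofReal.comp (by fun_prop)

theorem enorm_sq_le_lintegral_segment {φ : E → ℝ} (hφ : ContDiff ℝ ∞ φ) {ν : E} (hν : ‖ν‖ = 1)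
    {r : ℝ} (hr : 0 < r) (y : E) :
    ‖φ y‖ₑ ^ 2 ≤ ENNReal.ofReal ((1 + r) / r) *
      ∫⁻ s in Set.Ioc 0 r, energyDensity φ (y + s • ν) := by
  have hc : Continuous φ := hφ.continuous
  have hgc := continuous_gradient_of_contDiff hφ
  have h := sq_le_integral_segment hφ hν hr y
  simp_rw [energyDensity_eq_ofReal]
  rw [← ofReal_integral_eq_lintegral_ofReal, ← ENNReal.ofReal_mul (by positivity),
    Real.enorm_eq_ofReal_abs, ← ENNReal.ofReal_pow (abs_nonneg _), sq_abs]
  · apply ENNReal.ofReal_le_ofReal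
    rw [intervalIntegral.integral_of_le hr.le] at h
    rw [div_mul_eq_mul_div, le_div_iff₀ hr, mul_comm]
    exact h
  · exact (intervalIntegrable_iff_integrableOn_Ioc_of_le hr.le).mp
      (Continuous.intervalIntegrable (by fun_prop) _ _)
  · exact ae_of_all _ fun s => by positivity

/-- The squared `H¹(Ω)` norm of a smooth function, as an extended nonnegative number. -/
noncomputable def sobolevEnergy [MeasurableSpace E] [BorelSpace E] [FiniteDimensional ℝ E]
    (Ω : Set E) (φ : E → ℝ) : ENNReal :=
  ∫⁻ x in Ω, energyDensity φ x

/-- The measure `μ` is left general so that the same argument serves the surface measure (trace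
inequality) and Lebesgue measure on a thin layer (smallness near the boundary). -/
theorem lintegral_enorm_sq_le_of_segment [MeasurableSpace E] [BorelSpace E]
    [FiniteDimensional ℝ E] {Ω : Set E} {μ : Measure E} {C : ENNReal} {ν : E} (hν : ‖ν‖ = 1)
    {r : ℝ} (hr : 0 < r)
    (h : ∀ F : E → ENNReal, Measurable F →
      ∫⁻ y, (∫⁻ s in Set.Ioc 0 r, F (y + s • ν)) ∂μ ≤ C * ∫⁻ y in Ω, F y)
    {φ : E → ℝ} (hφ : ContDiff ℝ ∞ φ) :
    ∫⁻ y, ‖φ y‖ₑ ^ 2 ∂μ ≤ ENNReal.ofReal ((1 + r) / r) * (C * sobolevEnergy Ω φ) := by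
  calc ∫⁻ y, ‖φ y‖ₑ ^ 2 ∂μ
      ≤ ∫⁻ y, ENNReal.ofReal ((1 + r) / r) *
          (∫⁻ s in Set.Ioc 0 r, energyDensity φ (y + s • ν)) ∂μ :=
        lintegral_mono fun y => enorm_sq_le_lintegral_segment hφ hν hr y
    _ = ENNReal.ofReal ((1 + r) / r) *
          ∫⁻ y, (∫⁻ s in Set.Ioc 0 r, energyDensity φ (y + s • ν)) ∂μ :=
        lintegral_const_mul' _ _ ENNReal.ofReal_ne_top
    _ ≤ _ := by
        gcongr
        exact h _ (continuous_energyDensity hφ).measurable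

end Segment

/-! ### Trace inequality and mass near the boundary -/

section Domain

variable {n : ℕ} {Ω : Set (EuclideanSpace ℝ (Fin n))}

theorem IsBoundedLipschitzDomain.isCompact_closure (hΩ : IsBoundedLipschitzDomain Ω) :
    IsCompact (closure Ω) :=
  hΩ.isBounded.isCompact_closure

theorem IsBoundedLipschitzDomain.isCompact_frontier (hΩ : IsBoundedLipschitzDomain Ω) :
    IsCompact (frontier Ω) :=
  hΩ.isCompact_closure.of_isClosed_subset isClosed_frontier frontier_subset_closure

/-- The trace inequality for smooth functions. -/
theorem IsBoundedLipschitzDomain.exists_trace_inequality (hΩ : IsBoundedLipschitzDomain Ω) :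
    ∃ C : NNReal, ∀ φ : EuclideanSpace ℝ (Fin n) → ℝ, ContDiff ℝ ∞ φ →
      ∫⁻ y, ‖φ y‖ₑ ^ 2 ∂(surfaceMeasure Ω) ≤ C * sobolevEnergy Ω φ := by
  choose! r hr ν hν _ hC _ using fun x (hx : x ∈ frontier Ω) => hΩ.exists_nhds_segment_bounds hx
  choose! C hC using hC
  obtain ⟨t, htf, ht⟩ := hΩ.isCompact_frontier.elim_nhds_subcover
    (fun x => Metric.ball x (r x)) fun x hx => Metric.ball_mem_nhds x (hr x hx)
  refine ⟨∑ x ∈ t, Real.toNNReal ((1 + r x) / r x) * C x, fun φ hφ => ?_⟩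
  calc ∫⁻ y, ‖φ y‖ₑ ^ 2 ∂(surfaceMeasure Ω)
      ≤ ∫⁻ y in ⋃ x ∈ t, Metric.ball x (r x), ‖φ y‖ₑ ^ 2 ∂(surfaceMeasure Ω) := by
        have : surfaceMeasure Ω ≤
            (surfaceMeasure Ω).restrict (⋃ x ∈ t, Metric.ball x (r x)) := by
          rw [surfaceMeasure, Measure.restrict_restrict
            (t.measurableSet_biUnion fun _ _ => measurableSet_ball),
            Set.inter_eq_self_of_subset_right ht]
        exact lintegral_mono' this le_rfl
    _ ≤ ∑ x ∈ t, ∫⁻ y in Metric.ball x (r x), ‖φ y‖ₑ ^ 2 ∂(surfaceMeasure Ω) :=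
        setLIntegral_biUnion_finset_le _ _ _ _
    _ ≤ ∑ x ∈ t, ENNReal.ofReal ((1 + r x) / r x) * (C x * sobolevEnergy Ω φ) := by
        gcongr with x hx
        exact lintegral_enorm_sq_le_of_segment (hν x (htf x hx)) (hr x (htf x hx))
          (hC x (htf x hx)) hφ
    _ = _ := by
        rw [ENNReal.ofNNReal_finsetSum, Finset.sum_mul]
        simp [ENNReal.ofReal, mul_assoc]

/-- Functions bounded in `H¹` have little mass near the boundary: up to a compact subset of `Ω`,
the `L²` norm is controlled by an arbitrarily small multiple of the `H¹` norm. -/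
theorem IsBoundedLipschitzDomain.exists_compact_lintegral_le (hΩ : IsBoundedLipschitzDomain Ω)
    {η : NNReal} (hη : 0 < η) :
    ∃ K : Set (EuclideanSpace ℝ (Fin n)), IsCompact K ∧ K ⊆ Ω ∧
      ∀ φ : EuclideanSpace ℝ (Fin n) → ℝ, ContDiff ℝ ∞ φ →
        ∫⁻ y in Ω, ‖φ y‖ₑ ^ 2 ≤ η * sobolevEnergy Ω φ + ∫⁻ y in K, ‖φ y‖ₑ ^ 2 := by
  choose! r hr ν hν _ _ hN using fun x (hx : x ∈ frontier Ω) => hΩ.exists_nhds_segment_bounds hx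
  obtain ⟨t, htf, ht⟩ := hΩ.isCompact_frontier.elim_nhds_subcover
    (fun x => Metric.ball x (r x)) fun x hx => Metric.ball_mem_nhds x (hr x hx)
  -- Layer thickness chosen so that, after the segment factor `(1 + r x) / r x`, each of the
  -- `t.card` layers contributes at most `η / (t.card + 1)` times the energy. The `+ 1` avoids
  -- division by zero when the cover is empty.
  have hδ : ∀ x ∈ t, 0 < (η : ℝ) / (t.card + 1) / ((1 + r x) / r x) := fun x hx => by
    have := hr x (htf x hx)
    positivity
  choose! N hNo hNf hN using fun x (hx : x ∈ t) => hN x (htf x hx) _ (hδ x hx)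
  -- The compact set is what remains of the closure after removing the open layers. It avoids the
  -- frontier because the layers cover it.
  have hKeq : closure Ω \ ⋃ x ∈ t, N x ⊆ Ω := by
    rintro y ⟨hy, hyN⟩
    by_contra hyΩ
    have hyf : y ∈ frontier Ω := by
      rw [hΩ.isOpen.frontier_eq]
      exact ⟨hy, hyΩ⟩
    obtain ⟨x, hx, hyx⟩ := Set.mem_iUnion₂.mp (ht hyf)
    exact hyN (Set.mem_biUnion hx (hNf x hx ⟨hyf, hyx⟩))
  have hKc : IsCompact (closure Ω \ ⋃ x ∈ t, N x) :=
    hΩ.isCompact_closure.diff (isOpen_biUnion fun x hx => hNo x hx)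
  refine ⟨_, hKc, hKeq, fun φ hφ => ?_⟩
  have hcover : Ω ⊆ (⋃ x ∈ t, N x ∩ Ω) ∪ (closure Ω \ ⋃ x ∈ t, N x) := by
    intro y hy
    by_cases h : y ∈ ⋃ x ∈ t, N x
    · left
      obtain ⟨x, hx, hyx⟩ := Set.mem_iUnion₂.mp h
      exact Set.mem_biUnion hx ⟨hyx, hy⟩
    · exact Or.inr ⟨subset_closure hy, h⟩
  calc ∫⁻ y in Ω, ‖φ y‖ₑ ^ 2
      ≤ ∫⁻ y in (⋃ x ∈ t, N x ∩ Ω) ∪ (closure Ω \ ⋃ x ∈ t, N x), ‖φ y‖ₑ ^ 2 :=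
        lintegral_mono_set hcover
    _ ≤ (∫⁻ y in ⋃ x ∈ t, N x ∩ Ω, ‖φ y‖ₑ ^ 2) + ∫⁻ y in closure Ω \ ⋃ x ∈ t, N x, ‖φ y‖ₑ ^ 2 :=
        lintegral_union_le _ _ _
    _ ≤ (∑ x ∈ t, ∫⁻ y in N x ∩ Ω, ‖φ y‖ₑ ^ 2) +
          ∫⁻ y in closure Ω \ ⋃ x ∈ t, N x, ‖φ y‖ₑ ^ 2 := by
        gcongr
        exact setLIntegral_biUnion_finset_le _ _ _ _
    _ ≤ (∑ x ∈ t, ENNReal.ofReal ((η : ℝ) / (t.card + 1)) * sobolevEnergy Ω φ) +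
          ∫⁻ y in closure Ω \ ⋃ x ∈ t, N x, ‖φ y‖ₑ ^ 2 := by
        gcongr with x hx
        have hrx := hr x (htf x hx)
        refine (lintegral_enorm_sq_le_of_segment (hν x (htf x hx)) hrx (hN x hx) hφ).trans_eq ?_
        rw [← mul_assoc, ← ENNReal.ofReal_mul (by positivity)]
        congr 2
        field_simp
    _ ≤ _ := by
        gcongr
        rw [Finset.sum_const, nsmul_eq_mul, ← mul_assoc]
        gcongr
        rw [← ENNReal.ofReal_natCast, ← ENNReal.ofReal_mul (by positivity),
          ← ENNReal.ofReal_coe_nnreal]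
        apply ENNReal.ofReal_le_ofReal
        rw [mul_div_assoc', div_le_iff₀ (by positivity)]
        nlinarith [η.2]

end Domain

/-! ### Comparison with local averages -/

theorem sq_lintegral_le {α : Type*} [MeasurableSpace α] {μ : Measure α} {g : α → ENNReal}
    (hg : AEMeasurable g μ) : (∫⁻ a, g a ∂μ) ^ 2 ≤ μ Set.univ * ∫⁻ a, g a ^ 2 ∂μ := by
  have h := ENNReal.lintegral_mul_le_Lp_mul_Lq μ Real.HolderConjugate.two_two hg
    (aemeasurable_const (b := (1 : ENNReal)))
  simp only [Pi.mul_apply, mul_one, ENNReal.rpow_ofNat, one_pow, lintegral_const, one_mul] at h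
  calc (∫⁻ a, g a ∂μ) ^ 2
      ≤ ((∫⁻ a, g a ^ 2 ∂μ) ^ (1 / 2 : ℝ) * μ Set.univ ^ (1 / 2 : ℝ)) ^ 2 := by gcongr
    _ = _ := by
        rw [mul_pow, ← ENNReal.rpow_natCast, ← ENNReal.rpow_natCast, ← ENNReal.rpow_mul,
          ← ENNReal.rpow_mul, mul_comm]
        norm_num

theorem enorm_integral_sq_le {α F : Type*} [MeasurableSpace α] {μ : Measure α}
    [NormedAddCommGroup F] [NormedSpace ℝ F] {f : α → F} (hf : AEStronglyMeasurable f μ) :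
    ‖∫ a, f a ∂μ‖ₑ ^ 2 ≤ μ Set.univ * ∫⁻ a, ‖f a‖ₑ ^ 2 ∂μ :=
  (pow_le_pow_left' (enorm_integral_le_lintegral_enorm f) 2).trans (sq_lintegral_le hf.enorm)

section Averages

variable {E : Type*} [NormedAddCommGroup E] [InnerProductSpace ℝ E] [CompleteSpace E]

theorem enorm_sub_sq_le_lintegral_gradient {φ : E → ℝ} (hφ : ContDiff ℝ ∞ φ) (x v : E) :
    ‖φ (x + v) - φ x‖ₑ ^ 2 ≤
      ‖v‖ₑ ^ 2 * ∫⁻ s in Set.Ioc (0 : ℝ) 1, ‖gradient φ (x + s • v)‖ₑ ^ 2 := by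
  have hgc := continuous_gradient_of_contDiff hφ
  have hc : Continuous fun s : ℝ => (inner ℝ (gradient φ (x + s • v)) v : ℝ) := by fun_prop
  have h := intervalIntegral.integral_eq_sub_of_hasDerivAt (a := 0) (b := 1)
    (fun s _ => hasDerivAt_comp_line hφ x v s) (hc.intervalIntegrable _ _)
  rw [intervalIntegral.integral_of_le zero_le_one] at h
  simp only [one_smul, zero_smul, add_zero] at h
  rw [← h]
  refine (enorm_integral_sq_le hc.aestronglyMeasurable).trans ?_
  simp only [MeasurableSet.univ, Measure.restrict_apply, Set.univ_inter, Real.volume_Ioc, sub_zero,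
    ENNReal.ofReal_one, one_mul]
  rw [← lintegral_const_mul' _ _ (by finiteness)]
  apply lintegral_mono
  intro s
  beta_reduce
  rw [mul_comm, ← mul_pow]
  exact pow_le_pow_left' (by
    simp only [enorm_eq_nnnorm]
    exact_mod_cast nnnorm_inner_le_nnnorm (𝕜 := ℝ) _ _) 2

/-- Expand the square in ∫|φ(x + v) - φ(x)|² over the ball, discard the nonnegative term ∫φ(x + v)²,
and absorb the cross term into half of |B| φ(x)² by Young's inequality. This absorption produces the
constants 2 and 4. -/
theorem enorm_sq_le_average [MeasurableSpace E] [BorelSpace E] [FiniteDimensional ℝ E]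
    {φ : E → ℝ} (hφ : Continuous φ) (x : E) {ρ : ℝ} (hρ : 0 < ρ) :
    ‖φ x‖ₑ ^ 2 ≤ (volume (Metric.closedBall (0 : E) ρ))⁻¹ *
      (2 * ∫⁻ v in Metric.closedBall 0 ρ, ‖φ (x + v) - φ x‖ₑ ^ 2) +
      4 * (volume (Metric.closedBall (0 : E) ρ))⁻¹ ^ 2 *
        ‖∫ v in Metric.closedBall 0 ρ, φ (x + v)‖ₑ ^ 2 := by
  set B := Metric.closedBall (0 : E) ρ with hB
  have hBc : IsCompact B := isCompact_closedBall _ _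
  have hm0 : 0 < volume.real B := by
    rw [measureReal_def]
    exact ENNReal.toReal_pos (Metric.measure_closedBall_pos _ _ hρ).ne' hBc.measure_ne_top
  set m := volume.real B with hm
  have hmB : volume B = ENNReal.ofReal m := (ofReal_measureReal hBc.measure_ne_top).symm
  set a := ∫ v in B, φ (x + v) with ha
  have hi1 : IntegrableOn (fun v => φ (x + v)) B :=
    (by fun_prop : Continuous _).continuousOn.integrableOn_compact hBc
  have hi2 : IntegrableOn (fun v => (φ (x + v) - φ x) ^ 2) B :=
    (by fun_prop : Continuous _).continuousOn.integrableOn_compact hBc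
  have hi3 : IntegrableOn (fun v => φ (x + v) ^ 2) B :=
    (by fun_prop : Continuous _).continuousOn.integrableOn_compact hBc
  have hreal : φ x ^ 2 ≤ m⁻¹ * (2 * ∫ v in B, (φ (x + v) - φ x) ^ 2) + 4 * m⁻¹ ^ 2 * a ^ 2 := by
    have hexp : ∫ v in B, (φ (x + v) - φ x) ^ 2 =
        (∫ v in B, φ (x + v) ^ 2) - 2 * φ x * a + m * φ x ^ 2 := by
      have : ∀ v, (φ (x + v) - φ x) ^ 2 = φ (x + v) ^ 2 - 2 * φ x * φ (x + v) + φ x ^ 2 := by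
        intro v; ring
      simp_rw [this]
      have hc : IntegrableOn (fun _ : E => φ x ^ 2) B :=
        continuous_const.continuousOn.integrableOn_compact hBc
      have h1 := integral_add (hi3.sub (hi1.const_mul (2 * φ x))) hc
      have h2 := integral_sub hi3 (hi1.const_mul (2 * φ x))
      simp only [Pi.sub_apply] at h1
      rw [h1, h2, integral_const_mul, setIntegral_const, smul_eq_mul]
    have hpos : 0 ≤ ∫ v in B, φ (x + v) ^ 2 := integral_nonneg fun v => sq_nonneg _
    -- Young's inequality, from the square `(m * φ x - 2 * a) ^ 2 ≥ 0` divided by `2 * m`.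
    have h1 : 2 * φ x * a ≤ m * φ x ^ 2 / 2 + 2 * m⁻¹ * a ^ 2 := by
      have h2 : 0 ≤ (m * φ x - 2 * a) ^ 2 / (2 * m) := by positivity
      have h3 : (m * φ x - 2 * a) ^ 2 / (2 * m) =
          m * φ x ^ 2 / 2 + 2 * m⁻¹ * a ^ 2 - 2 * φ x * a := by
        field_simp
        ring
      linarith
    have h4 : φ x ^ 2 = m⁻¹ * (2 * (m * φ x ^ 2 / 2)) := by field_simp
    calc φ x ^ 2 = m⁻¹ * (2 * (m * φ x ^ 2 / 2)) := h4
      _ ≤ m⁻¹ * (2 * ((∫ v in B, (φ (x + v) - φ x) ^ 2) + 2 * m⁻¹ * a ^ 2)) := by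
          gcongr
          linarith
      _ = _ := by ring
  have hsq : ∀ t : ℝ, ‖t‖ₑ ^ 2 = ENNReal.ofReal (t ^ 2) := fun t => by
    rw [Real.enorm_eq_ofReal_abs, ← ENNReal.ofReal_pow (abs_nonneg _), sq_abs]
  simp_rw [hsq]
  rw [← ofReal_integral_eq_lintegral_ofReal hi2 (ae_of_all _ fun v => sq_nonneg _), hmB,
    ← ENNReal.ofReal_inv_of_pos hm0, ← ENNReal.ofReal_ofNat 2, ← ENNReal.ofReal_ofNat 4,
    ← ENNReal.ofReal_pow (by positivity), ← ENNReal.ofReal_mul (by positivity),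
    ← ENNReal.ofReal_mul (by positivity), ← ENNReal.ofReal_mul (by positivity),
    ← ENNReal.ofReal_mul (by positivity),
    ← ENNReal.ofReal_add (mul_nonneg (by positivity)
      (mul_nonneg (by positivity) (integral_nonneg fun v => sq_nonneg _))) (by positivity)]
  exact ENNReal.ofReal_le_ofReal hreal

/-- For |v| ≤ ρ the segments from `K` in direction `v` stay in `Ω`, so the difference φ(· + v) - φ
has squared L²(K) norm at most ρ² ∫_Ω |∇φ|². Averaging over `v` and inserting the pointwise bound
leaves only the ball averages. -/
theorem lintegral_compact_le_average [MeasurableSpace E] [BorelSpace E] [FiniteDimensional ℝ E]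
    {Ω K : Set E} (hΩ : IsOpen Ω) (hK : IsCompact K) {ρ : ℝ} (hρ : 0 < ρ)
    (hKΩ : Metric.cthickening ρ K ⊆ Ω) {φ : E → ℝ} (hφ : ContDiff ℝ ∞ φ) :
    ∫⁻ x in K, ‖φ x‖ₑ ^ 2 ≤ 2 * ENNReal.ofReal ρ ^ 2 * sobolevEnergy Ω φ +
      ∫⁻ x in K, 4 * (volume (Metric.closedBall (0 : E) ρ))⁻¹ ^ 2 *
        ‖∫ v in Metric.closedBall 0 ρ, φ (x + v)‖ₑ ^ 2 := by
  have hc := hφ.continuous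
  have hgc := continuous_gradient_of_contDiff hφ
  have hmem : ∀ x ∈ K, ∀ v ∈ Metric.closedBall (0 : E) ρ, ∀ s ∈ Set.Ioc (0 : ℝ) 1,
      x + s • v ∈ Ω := by
    intro x hx v hv s hs
    apply hKΩ
    apply Metric.mem_cthickening_of_dist_le _ x _ _ hx
    rw [dist_eq_norm, add_sub_cancel_left, norm_smul, Real.norm_of_nonneg hs.1.le]
    have hv' : ‖v‖ ≤ ρ := by simpa using hv
    calc s * ‖v‖ ≤ 1 * ‖v‖ := by gcongr; exact hs.2
      _ ≤ ρ := by rwa [one_mul]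
  set B := Metric.closedBall (0 : E) ρ with hB
  have hB0 : volume B ≠ 0 := (Metric.measure_closedBall_pos _ _ hρ).ne'
  have hBt : volume B ≠ ⊤ := (isCompact_closedBall _ _).measure_ne_top
  have hdiff : ∫⁻ x in K, ∫⁻ v in B, ‖φ (x + v) - φ x‖ₑ ^ 2 ≤
      volume B * (ENNReal.ofReal ρ ^ 2 * sobolevEnergy Ω φ) := by
    calc ∫⁻ x in K, ∫⁻ v in B, ‖φ (x + v) - φ x‖ₑ ^ 2
        = ∫⁻ v in B, ∫⁻ x in K, ‖φ (x + v) - φ x‖ₑ ^ 2 := by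
          apply lintegral_lintegral_swap
          apply Continuous.aemeasurable
          unfold Function.uncurry
          fun_prop
      _ ≤ ∫⁻ _ in B, ENNReal.ofReal ρ ^ 2 * sobolevEnergy Ω φ := by
          apply setLIntegral_mono' measurableSet_closedBall
          intro v hv
          have hv' : ‖v‖ₑ ≤ ENNReal.ofReal ρ := by
            rw [← ofReal_norm]
            exact ENNReal.ofReal_le_ofReal (by simpa using hv)
          calc ∫⁻ x in K, ‖φ (x + v) - φ x‖ₑ ^ 2
              ≤ ∫⁻ x in K, ENNReal.ofReal ρ ^ 2 *
                  ∫⁻ s in Set.Ioc (0 : ℝ) 1, ‖gradient φ (x + s • v)‖ₑ ^ 2 := by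
                apply lintegral_mono
                intro x
                exact (enorm_sub_sq_le_lintegral_gradient hφ x v).trans
                  (mul_le_mul' (pow_le_pow_left' hv' 2) le_rfl)
            _ = ENNReal.ofReal ρ ^ 2 *
                  ∫⁻ s in Set.Ioc (0 : ℝ) 1, ∫⁻ x in K, ‖gradient φ (x + s • v)‖ₑ ^ 2 := by
                rw [lintegral_const_mul' _ _ (by finiteness)]
                congr 1
                apply lintegral_lintegral_swap
                apply Continuous.aemeasurable
                unfold Function.uncurry
                fun_prop
            _ ≤ ENNReal.ofReal ρ ^ 2 * ∫⁻ _ in Set.Ioc (0 : ℝ) 1, sobolevEnergy Ω φ := by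
                gcongr ENNReal.ofReal ρ ^ 2 * ?_
                apply setLIntegral_mono' measurableSet_Ioc
                intro s hs
                calc ∫⁻ x in K, ‖gradient φ (x + s • v)‖ₑ ^ 2
                    ≤ ∫⁻ x in K, Ω.indicator (fun y => ‖gradient φ y‖ₑ ^ 2) (x + s • v) := by
                      apply setLIntegral_mono' hK.measurableSet
                      intro x hx
                      rw [Set.indicator_of_mem (hmem x hx v hv s hs)]
                  _ ≤ ∫⁻ x, Ω.indicator (fun y => ‖gradient φ y‖ₑ ^ 2) (x + s • v) :=
                      setLIntegral_le_lintegral _ _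
                  _ = ∫⁻ x, Ω.indicator (fun y => ‖gradient φ y‖ₑ ^ 2) x :=
                      lintegral_add_right_eq_self _ _
                  _ = ∫⁻ x in Ω, ‖gradient φ x‖ₑ ^ 2 := lintegral_indicator hΩ.measurableSet _
                  _ ≤ sobolevEnergy Ω φ := lintegral_mono fun x => le_add_self
            _ = _ := by simp
      _ = _ := by rw [setLIntegral_const, mul_comm]
  have hm1 : Measurable fun x => ∫⁻ v in B, ‖φ (x + v) - φ x‖ₑ ^ 2 := by
    apply Measurable.lintegral_prod_right
    apply Continuous.measurable
    fun_prop
  calc ∫⁻ x in K, ‖φ x‖ₑ ^ 2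
      ≤ ∫⁻ x in K, ((volume B)⁻¹ * (2 * ∫⁻ v in B, ‖φ (x + v) - φ x‖ₑ ^ 2) +
          4 * (volume B)⁻¹ ^ 2 * ‖∫ v in B, φ (x + v)‖ₑ ^ 2) :=
        lintegral_mono fun x => enorm_sq_le_average hc x hρ
    _ = (∫⁻ x in K, (volume B)⁻¹ * (2 * ∫⁻ v in B, ‖φ (x + v) - φ x‖ₑ ^ 2)) +
          ∫⁻ x in K, 4 * (volume B)⁻¹ ^ 2 * ‖∫ v in B, φ (x + v)‖ₑ ^ 2 :=
        lintegral_add_left ((hm1.const_mul _).const_mul _) _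
    _ ≤ _ := by
        gcongr ?_ + _
        rw [lintegral_const_mul' _ _ (ENNReal.inv_ne_top.mpr hB0),
          lintegral_const_mul' _ _ (by finiteness)]
        calc (volume B)⁻¹ * (2 * ∫⁻ x in K, ∫⁻ v in B, ‖φ (x + v) - φ x‖ₑ ^ 2)
            ≤ (volume B)⁻¹ * (2 * (volume B * (ENNReal.ofReal ρ ^ 2 * sobolevEnergy Ω φ))) := by
              gcongr
          _ = ((volume B)⁻¹ * volume B) * (2 * ENNReal.ofReal ρ ^ 2 * sobolevEnergy Ω φ) := by
              ring
          _ = _ := by rw [ENNReal.inv_mul_cancel hB0 hBt, one_mul]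

end Averages

/-- Rellich's theorem for smooth functions: if `φ m` is bounded in `H¹(Ω)` and its averages over
balls in `Ω` tend to `0`, then `φ m → 0` in `L²(Ω)`. -/
theorem IsBoundedLipschitzDomain.tendsto_lintegral_sq_of_tendsto_ball {n : ℕ}
    {Ω : Set (EuclideanSpace ℝ (Fin n))} (hΩ : IsBoundedLipschitzDomain Ω)
    {φ : ℕ → EuclideanSpace ℝ (Fin n) → ℝ} (hφ : ∀ m, ContDiff ℝ ∞ (φ m)) {M : NNReal}
    (hM : ∀ m, sobolevEnergy Ω (φ m) ≤ M)
    (hball : ∀ x ρ, Metric.closedBall x ρ ⊆ Ω →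
      Tendsto (fun m => ∫ y in Metric.closedBall x ρ, φ m y) atTop (𝓝 0)) :
    Tendsto (fun m => ∫⁻ x in Ω, ‖φ m x‖ₑ ^ 2) atTop (𝓝 0) := by
  rw [ENNReal.tendsto_nhds_zero]
  intro ε hε
  by_cases hεt : ε = ⊤
  · simp [hεt]
  lift ε to NNReal using hεt
  have hε' : 0 < ε := by exact_mod_cast hε
  -- The tolerance is split into thirds: boundary layer, oscillation at scale `ρ`, ball averages.
  -- Energies are at most `M`, so this choice makes the layer cost at most `ε / 3`, and ρ² ≤ ε /
  -- (6(M + 1)) below does the same for the oscillation term 2ρ²M.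
  obtain ⟨K, hK, hKΩ, hKle⟩ := hΩ.exists_compact_lintegral_le (η := ε / (3 * (M + 1)))
    (by positivity)
  obtain ⟨R, hR, hRΩ⟩ := hK.exists_cthickening_subset_open hΩ.isOpen hKΩ
  set ρ := min R (Real.sqrt (ε / (6 * (M + 1)))) with hρdef
  have hρ : 0 < ρ := lt_min hR (Real.sqrt_pos.mpr (by positivity))
  have hρΩ : Metric.cthickening ρ K ⊆ Ω := (Metric.cthickening_mono (min_le_left _ _) _).trans hRΩ
  set B := Metric.closedBall (0 : EuclideanSpace ℝ (Fin n)) ρ with hB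
  have hB0 : volume B ≠ 0 := (Metric.measure_closedBall_pos _ _ hρ).ne'
  have hBt : volume B ≠ ⊤ := (isCompact_closedBall _ _).measure_ne_top
  have hxB : ∀ x ∈ K, Metric.closedBall x ρ ⊆ Ω := fun x hx =>
    (Metric.closedBall_subset_cthickening hx ρ).trans hρΩ
  have hshift : ∀ x m, ∫ v in B, φ m (x + v) = ∫ y in Metric.closedBall x ρ, φ m y := by
    intro x m
    rw [← integral_indicator measurableSet_closedBall,
      ← integral_indicator measurableSet_closedBall,
      ← integral_add_left_eq_self (fun y => (Metric.closedBall x ρ).indicator (φ m) y) x]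
    congr 1 with v
    by_cases hv : v ∈ B
    · have : x + v ∈ Metric.closedBall x ρ := by simpa [hB] using hv
      rw [Set.indicator_of_mem hv, Set.indicator_of_mem this]
    · have : x + v ∉ Metric.closedBall x ρ := by simpa [hB] using hv
      rw [Set.indicator_of_notMem hv, Set.indicator_of_notMem this]
  -- Dominated convergence on `K`: the averages tend to 0 pointwise, and Cauchy–Schwarz with the
  -- energy bound gives a constant majorant.
  have hlim : Tendsto (fun m => ∫⁻ x in K, 4 * (volume B)⁻¹ ^ 2 *
      ‖∫ v in B, φ m (x + v)‖ₑ ^ 2) atTop (𝓝 0) := by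
    have hc4 : 4 * (volume B)⁻¹ ^ 2 ≠ ⊤ := by
      have := ENNReal.inv_ne_top.mpr hB0
      finiteness
    have := tendsto_lintegral_of_dominated_convergence' (μ := volume.restrict K)
      (F := fun m x => 4 * (volume B)⁻¹ ^ 2 * ‖∫ v in B, φ m (x + v)‖ₑ ^ 2) (f := fun _ => 0)
      (fun _ => 4 * (volume B)⁻¹ ^ 2 * (volume B * M)) (fun m => ?_) (fun m => ?_) ?_ ?_
    · simpa using this
    · have hc := (hφ m).continuous
      have : StronglyMeasurable fun x => ∫ v in B, φ m (x + v) := by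
        apply StronglyMeasurable.integral_prod_right
        apply Continuous.stronglyMeasurable
        fun_prop
      exact ((this.measurable.enorm.pow_const 2).const_mul _).aemeasurable
    · filter_upwards [ae_restrict_mem hK.measurableSet] with x hx
      gcongr
      rw [hshift]
      refine (enorm_integral_sq_le (hφ m).continuous.aestronglyMeasurable).trans ?_
      rw [Measure.restrict_apply_univ, hB, ← Measure.addHaar_closedBall_center volume x]
      gcongr
      calc ∫⁻ y in Metric.closedBall x ρ, ‖φ m y‖ₑ ^ 2 ≤ ∫⁻ y in Ω, ‖φ m y‖ₑ ^ 2 :=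
            lintegral_mono_set (hxB x hx)
        _ ≤ sobolevEnergy Ω (φ m) := lintegral_mono fun y => le_self_add
        _ ≤ M := hM m
    · rw [setLIntegral_const]
      have := hK.measure_ne_top (μ := volume)
      finiteness
    · filter_upwards [ae_restrict_mem hK.measurableSet] with x hx
      simp_rw [hshift]
      have h1 := ENNReal.Tendsto.pow (n := 2) (hball x ρ (hxB x hx)).enorm
      have h2 := ENNReal.Tendsto.const_mul h1 (Or.inr hc4)
      simpa using h2
  have hε3 : (0 : ENNReal) < ((ε / 3 : NNReal) : ENNReal) := by
    exact_mod_cast (by positivity : 0 < ε / 3)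
  filter_upwards [(ENNReal.tendsto_nhds_zero.mp hlim) _ hε3] with m hm
  have h1 : ((ε / (3 * (M + 1)) : NNReal) : ENNReal) * sobolevEnergy Ω (φ m) ≤
      ((ε / 3 : NNReal) : ENNReal) := by
    calc _ ≤ ((ε / (3 * (M + 1)) : NNReal) : ENNReal) * M := by gcongr; exact hM m
      _ ≤ _ := by
        rw [← ENNReal.coe_mul, ENNReal.coe_le_coe, div_mul_eq_mul_div,
          div_le_div_iff₀ (by positivity) (by positivity)]
        have : ε * M * 3 = ε * (3 * M) := by ring
        rw [this]
        gcongr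
        exact le_self_add
  have h2 : 2 * ENNReal.ofReal ρ ^ 2 * sobolevEnergy Ω (φ m) ≤ ((ε / 3 : NNReal) : ENNReal) := by
    have hρ2 : ρ ^ 2 ≤ ε / (6 * (M + 1)) := by
      calc ρ ^ 2 ≤ Real.sqrt (ε / (6 * (M + 1))) ^ 2 := by
            gcongr
            exact min_le_right _ _
        _ = _ := Real.sq_sqrt (by positivity)
    calc 2 * ENNReal.ofReal ρ ^ 2 * sobolevEnergy Ω (φ m)
        ≤ ENNReal.ofReal 2 * ENNReal.ofReal (ρ ^ 2) * ENNReal.ofReal M := by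
          rw [ENNReal.ofReal_pow hρ.le, ENNReal.ofReal_ofNat, ENNReal.ofReal_coe_nnreal]
          gcongr
          exact hM m
      _ = ENNReal.ofReal (2 * ρ ^ 2 * M) := by
          rw [ENNReal.ofReal_mul (by positivity), ENNReal.ofReal_mul (by positivity)]
      _ ≤ ENNReal.ofReal ((ε / 3 : NNReal) : ℝ) := by
          apply ENNReal.ofReal_le_ofReal
          push_cast
          calc 2 * ρ ^ 2 * M ≤ 2 * (ε / (6 * (M + 1))) * (M + 1) := by
                gcongr
                linarith
            _ = ε / 3 := by
                field_simp
                norm_num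
      _ = _ := ENNReal.ofReal_coe_nnreal
  calc ∫⁻ x in Ω, ‖φ m x‖ₑ ^ 2
      ≤ ((ε / (3 * (M + 1)) : NNReal) : ENNReal) * sobolevEnergy Ω (φ m) +
          ∫⁻ x in K, ‖φ m x‖ₑ ^ 2 := hKle _ (hφ m)
    _ ≤ ((ε / 3 : NNReal) : ENNReal) + (((ε / 3 : NNReal) : ENNReal) +
          ((ε / 3 : NNReal) : ENNReal)) := by
        gcongr
        refine (lintegral_compact_le_average hΩ.isOpen hK hρ hρΩ (hφ m)).trans ?_
        gcongr
    _ = ε := by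
        rw [← ENNReal.coe_add, ← ENNReal.coe_add]
        congr 1
        ext
        push_cast
        ring

/-! ### Mollification in L² -/

theorem eLpNorm_two_sq {α F : Type*} [MeasurableSpace α] [NormedAddCommGroup F] (f : α → F)
    (μ : Measure α) : eLpNorm f 2 μ ^ 2 = ∫⁻ a, ‖f a‖ₑ ^ 2 ∂μ := by
  have := eLpNorm_nnreal_pow_eq_lintegral (f := f) (μ := μ) (p := 2) (by norm_num)
  simpa using this

theorem eLpNorm_two_le_iff {α F : Type*} [MeasurableSpace α] [NormedAddCommGroup F] {f : α → F}
    {μ : Measure α} {c : ENNReal} : eLpNorm f 2 μ ≤ c ↔ ∫⁻ a, ‖f a‖ₑ ^ 2 ∂μ ≤ c ^ 2 := by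
  rw [← eLpNorm_two_sq]
  exact (ENNReal.pow_le_pow_left_iff two_ne_zero).symm

section Mollification

variable {E : Type*} [NormedAddCommGroup E] [InnerProductSpace ℝ E] [FiniteDimensional ℝ E]
  [MeasurableSpace E] [BorelSpace E] {F : Type*} [NormedAddCommGroup F]

/-- This is the strong continuity of the translation action on L². -/
theorem tendsto_eLpNorm_translate_sub {f : E → F} (hf : MemLp f 2 volume) :
    Tendsto (fun z => eLpNorm (fun x => f (x - z) - f x) 2 volume) (𝓝 0) (𝓝 0) := by
  have : Fact ((2 : ENNReal) ≠ ⊤) := ⟨by simp⟩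
  have hcont : Continuous fun z : E => DomAddAct.mk (-z) +ᵥ hf.toLp f :=
    (DomAddAct.continuous_mk.comp continuous_neg).vadd continuous_const
  have h0 : Tendsto (fun z : E => edist (DomAddAct.mk (-z) +ᵥ hf.toLp f)
      (DomAddAct.mk (-(0 : E)) +ᵥ hf.toLp f)) (𝓝 0) (𝓝 0) :=
    tendsto_iff_edist_tendsto_0.mp (hcont.tendsto 0)
  refine h0.congr fun z => ?_
  rw [DomAddAct.mk_vadd_toLp, DomAddAct.mk_vadd_toLp, Lp.edist_toLp_toLp]
  congr 1
  ext x
  simp [sub_eq_neg_add]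

variable [NormedSpace ℝ F]

/-- The kernel is a probability density, so by Jensen the squared error at `x` is at most the
`k`-average of |f(x - z) - f(x)|². Tonelli then reduces to the translation errors over the support
of `k`, which need not be centred at 0. -/
theorem eLpNorm_average_translate_sub_le [CompleteSpace F] {f : E → F}
    (hfm : StronglyMeasurable f) (hf : MemLp f 2 volume) {k : E → ℝ} (hk : Continuous k)
    (hk0 : ∀ z, 0 ≤ k z) (hkc : HasCompactSupport k) (hk1 : ∫ z, k z = 1) {δ : ENNReal}
    (hδ : ∀ z, k z ≠ 0 → eLpNorm (fun x => f (x - z) - f x) 2 volume ≤ δ) :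
    eLpNorm (fun x => (∫ z, k z • f (x - z)) - f x) 2 volume ≤ δ := by
  set κ : Measure E := volume.withDensity fun z => ENNReal.ofReal (k z) with hκ
  have hkm : Measurable fun z => ENNReal.ofReal (k z) := hk.measurable.ennreal_ofReal
  have hki : Integrable k := hk.integrable_of_hasCompactSupport hkc
  have hκ1 : κ Set.univ = 1 := by
    rw [hκ, withDensity_apply _ MeasurableSet.univ, setLIntegral_univ,
      ← ofReal_integral_eq_lintegral_ofReal hki (ae_of_all _ hk0), hk1, ENNReal.ofReal_one]
  have : IsFiniteMeasure κ := ⟨by simp [hκ1]⟩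
  have hfx : ∀ x, StronglyMeasurable fun z => f (x - z) := fun x =>
    hfm.comp_measurable (by fun_prop)
  have hpt : ∀ x, ‖(∫ z, k z • f (x - z)) - f x‖ₑ ^ 2 ≤ ∫⁻ z, ‖f (x - z) - f x‖ₑ ^ 2 ∂κ := by
    intro x
    have hloc : LocallyIntegrable (fun z => f (x - z)) volume :=
      (hf.comp_measurePreserving (volume.measurePreserving_sub_left x)).locallyIntegrable
        (by norm_num)
    have h1 : Integrable fun z => k z • f (x - z) :=
      hloc.integrable_smul_left_of_hasCompactSupport hk hkc
    have h2 : (∫ z, k z • f (x - z)) - f x = ∫ z, k z • (f (x - z) - f x) := by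
      simp_rw [smul_sub]
      rw [integral_sub h1 (hki.smul_const _), integral_smul_const, hk1, one_smul]
    have hm : Measurable fun z => ‖f (x - z) - f x‖ₑ :=
      ((hfx x).sub stronglyMeasurable_const).enorm
    calc ‖(∫ z, k z • f (x - z)) - f x‖ₑ ^ 2
        ≤ (∫⁻ z, ‖k z • (f (x - z) - f x)‖ₑ) ^ 2 := by
          rw [h2]
          exact pow_le_pow_left' (enorm_integral_le_lintegral_enorm _) 2
      _ = (∫⁻ z, ‖f (x - z) - f x‖ₑ ∂κ) ^ 2 := by
          rw [hκ, lintegral_withDensity_eq_lintegral_mul _ hkm hm]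
          congr 2 with z
          rw [enorm_smul, Pi.mul_apply, Real.enorm_of_nonneg (hk0 z)]
      _ ≤ κ Set.univ * ∫⁻ z, ‖f (x - z) - f x‖ₑ ^ 2 ∂κ := sq_lintegral_le hm.aemeasurable
      _ = _ := by rw [hκ1, one_mul]
  rw [eLpNorm_two_le_iff]
  calc ∫⁻ x, ‖(∫ z, k z • f (x - z)) - f x‖ₑ ^ 2
      ≤ ∫⁻ x, ∫⁻ z, ‖f (x - z) - f x‖ₑ ^ 2 ∂κ := lintegral_mono hpt
    _ = ∫⁻ z, (∫⁻ x, ‖f (x - z) - f x‖ₑ ^ 2) ∂κ := by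
        apply lintegral_lintegral_swap
        apply Measurable.aemeasurable
        have h1 : StronglyMeasurable fun p : E × E => f (p.1 - p.2) - f p.1 :=
          (hfm.comp_measurable (by fun_prop)).sub (hfm.comp_measurable measurable_fst)
        exact h1.enorm.pow_const 2
    _ = ∫⁻ z, ENNReal.ofReal (k z) * (∫⁻ x, ‖f (x - z) - f x‖ₑ ^ 2) := by
        rw [hκ, lintegral_withDensity_eq_lintegral_mul _ hkm]
        · rfl
        · apply Measurable.lintegral_prod_right
          have h1 : StronglyMeasurable fun p : E × E => f (p.2 - p.1) - f p.2 :=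
            (hfm.comp_measurable (by fun_prop)).sub (hfm.comp_measurable measurable_snd)
          exact h1.enorm.pow_const 2
    _ ≤ ∫⁻ z, ENNReal.ofReal (k z) * δ ^ 2 := by
        apply lintegral_mono
        intro z
        by_cases hz : k z = 0
        · simp [hz]
        · exact mul_le_mul' le_rfl (eLpNorm_two_le_iff.mp (hδ z hz))
    _ = δ ^ 2 := by
        rw [lintegral_mul_const _ hkm, ← ofReal_integral_eq_lintegral_ofReal hki (ae_of_all _ hk0),
          hk1, ENNReal.ofReal_one, one_mul]

end Mollification

/-! ### Density of smooth functions in H¹ -/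

section Density

variable {n : ℕ} {Ω : Set (EuclideanSpace ℝ (Fin n))}

/-- Every point of `Ω` near `y₀` can be pushed into `Ω`, together with a proportionally large ball,
in one fixed direction. -/
def HasLocalCone {E : Type*} [NormedAddCommGroup E] [NormedSpace ℝ E] (Ω V : Set E) : Prop :=
  ∃ (ν : E) (c ε₀ : ℝ), 0 < c ∧ 0 < ε₀ ∧ ∀ y ∈ Ω ∩ V, ∀ ε, 0 < ε → ε ≤ ε₀ →
    Metric.closedBall (y + ε • ν) (c * ε) ⊆ Ω

/-- An interior point needs no push, so ν = 0 works there; a boundary point uses the cone of its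
chart. -/
theorem IsBoundedLipschitzDomain.exists_hasLocalCone (hΩ : IsBoundedLipschitzDomain Ω)
    {x : EuclideanSpace ℝ (Fin n)} (hx : x ∈ closure Ω) :
    ∃ r > 0, HasLocalCone Ω (Metric.ball x r) := by
  by_cases hxΩ : x ∈ Ω
  · obtain ⟨R, hR, hRΩ⟩ := Metric.isOpen_iff.mp hΩ.isOpen x hxΩ
    refine ⟨R / 2, by positivity, 0, 1, R / 2, one_pos, by positivity, fun y hy ε _ hεR => ?_⟩
    rw [smul_zero, add_zero, one_mul]
    refine (Metric.closedBall_subset_ball' ?_).trans hRΩ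
    have : dist y x < R / 2 := hy.2
    linarith
  · obtain ⟨r, hr, ν, -, ⟨c, hc, h⟩, -⟩ := hΩ.exists_nhds_segment_bounds
      (show x ∈ frontier Ω by rw [hΩ.isOpen.frontier_eq]; exact ⟨hx, hxΩ⟩)
    exact ⟨r, hr, ν, c, r, hc, hr, h⟩

theorem gradient_smul_comp_sub {E : Type*} [NormedAddCommGroup E] [InnerProductSpace ℝ E]
    [CompleteSpace E] {χ k : E → ℝ} (hχ : ContDiff ℝ ∞ χ) (hk : ContDiff ℝ ∞ k) (x t : E) :
    gradient (fun t => χ t * k (x - t)) t =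
      k (x - t) • gradient χ t - χ t • gradient k (x - t) := by
  have h1 : HasFDerivAt χ (fderiv ℝ χ t) t :=
    (hχ.differentiable (by simp)).differentiableAt.hasFDerivAt
  have h2 : HasFDerivAt k (fderiv ℝ k (x - t)) (x - t) :=
    (hk.differentiable (by simp)).differentiableAt.hasFDerivAt
  have h3 : HasFDerivAt (fun t => k (x - t)) (-fderiv ℝ k (x - t)) t := by
    have := h2.comp t ((hasFDerivAt_id t).const_sub x)
    rwa [ContinuousLinearMap.comp_neg, ContinuousLinearMap.comp_id] at this
  have h4 := (h1.mul h3).fderiv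
  rw [gradient, gradient, gradient]
  change (InnerProductSpace.toDual ℝ E).symm (fderiv ℝ (χ * fun t => k (x - t)) t) = _
  rw [h4, map_add, map_smul, map_smul, map_neg, smul_neg, add_comm, ← sub_eq_add_neg]

/-- Derivatives of a convolution fall on the smooth factor, so `f` need only be locally integrable.
-/
theorem contDiff_and_gradient_integral_mul_comp_sub {E : Type*} [NormedAddCommGroup E]
    [InnerProductSpace ℝ E] [FiniteDimensional ℝ E] [MeasurableSpace E] [BorelSpace E]
    {f k : E → ℝ} (hf : LocallyIntegrable f volume) (hk : ContDiff ℝ ∞ k)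
    (hkc : HasCompactSupport k) :
    ContDiff ℝ ∞ (fun x => ∫ t, f t * k (x - t)) ∧
      ∀ x, gradient (fun x => ∫ t, f t * k (x - t)) x = ∫ t, f t • gradient k (x - t) := by
  have hconv : (fun x => ∫ t, f t * k (x - t)) =
      convolution f k (ContinuousLinearMap.lsmul ℝ ℝ) volume := rfl
  rw [hconv]
  refine ⟨hkc.contDiff_convolution_right _ hf hk, fun x => ?_⟩
  have h := (hkc.hasFDerivAt_convolution_right (ContinuousLinearMap.lsmul ℝ ℝ) hf
    (hk.of_le (by simp)) x).fderiv
  have hint : Integrable fun t => f t • fderiv ℝ k (x - t) := by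
    have hc := hk.continuous_fderiv (by simp)
    apply hf.integrable_smul_right_of_hasCompactSupport (by fun_prop)
    exact (hkc.fderiv ℝ).comp_homeomorph (Homeomorph.subLeft x)
  have h2 : (convolution f (fderiv ℝ k)
      (ContinuousLinearMap.precompR E (ContinuousLinearMap.lsmul ℝ ℝ)) volume) x =
      ∫ t, f t • fderiv ℝ k (x - t) := by
    rw [convolution_def]
    rfl
  rw [gradient, h, h2]
  have h3 := ((InnerProductSpace.toDual ℝ E).symm.toContinuousLinearEquiv
    |>.toContinuousLinearMap).integral_comp_comm hint
  refine h3.symm.trans ?_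
  congr 1 with t : 1
  exact map_smul (InnerProductSpace.toDual ℝ E).symm _ _

/-- The mollified weak gradient is the gradient of the mollification wherever the localised kernel
is a test function. -/
theorem integral_smul_gradient_comp_sub_eq (hΩ : IsOpen Ω)
    {u : Lp ℝ 2 (volume.restrict Ω)} {G : Lp (EuclideanSpace ℝ (Fin n)) 2 (volume.restrict Ω)}
    (hu : HasWeakGradient Ω u G) {χ k : EuclideanSpace ℝ (Fin n) → ℝ} (hχ : ContDiff ℝ ∞ χ)
    (hχc : HasCompactSupport χ) (hks : ContDiff ℝ ∞ k) (x : EuclideanSpace ℝ (Fin n))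
    (hψ : IsTestFunction Ω fun t => χ t * k (x - t)) :
    ∫ t, Ω.indicator (fun y => χ y * u y) t • gradient k (x - t) =
      ∫ t, k (x - t) • Ω.indicator (fun y => χ y • G y + u y • gradient χ y) t := by
  have hw := hu _ hψ
  have hgs := gradient_smul_comp_sub hχ hks x
  have hint1 : Integrable (fun t => u t • gradient (fun t => χ t * k (x - t)) t)
      (volume.restrict Ω) := hψ.integrable_smul_gradient u
  have hχg : Continuous (gradient χ) := continuous_gradient_of_contDiff hχ
  have hχgc : HasCompactSupport (gradient χ) :=
    (hχc.fderiv ℝ).comp_left (map_zero (InnerProductSpace.toDual ℝ _).symm)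
  have hint2 : Integrable (fun t => u t • (k (x - t) • gradient χ t)) (volume.restrict Ω) := by
    have hkx : Continuous fun t => k (x - t) := hks.continuous.comp (by fun_prop)
    have hc2 : Continuous fun t => k (x - t) • gradient χ t := hkx.smul hχg
    have hc3 : HasCompactSupport ((fun t => k (x - t)) • gradient χ) := hχgc.smul_left
    exact memLp_one_iff_integrable.mp
      ((hc2.memLp_of_hasCompactSupport (p := 2) hc3).smul (Lp.memLp u))
  have hint3 : Integrable (fun t => (χ t * k (x - t)) • G t) (volume.restrict Ω) :=
    hψ.integrable_smul G
  -- The product rule for the test function ψ(t) = χ(t) k(x - t) turns χ ∇k(x - ·) into k(x - ·) ∇χ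
  -- - ∇ψ, and the term with ∇ψ is the one the weak gradient handles.
  have hL : ∫ t, Ω.indicator (fun y => χ y * u y) t • gradient k (x - t) =
      ∫ t in Ω, (u t • (k (x - t) • gradient χ t) -
      u t • gradient (fun t => χ t * k (x - t)) t) := by
    rw [← integral_indicator hΩ.measurableSet]
    congr 1 with t : 1
    by_cases ht : t ∈ Ω
    · rw [Set.indicator_of_mem ht, Set.indicator_of_mem ht, hgs, ← smul_sub, sub_sub_cancel,
        smul_smul, mul_comm]
    · rw [Set.indicator_of_notMem ht, Set.indicator_of_notMem ht, zero_smul]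
  have hR : ∫ t, k (x - t) • Ω.indicator (fun y => χ y • G y + u y • gradient χ y) t =
      ∫ t in Ω, (u t • (k (x - t) • gradient χ t) +
      (χ t * k (x - t)) • G t) := by
    rw [← integral_indicator hΩ.measurableSet]
    congr 1 with t : 1
    by_cases ht : t ∈ Ω
    · rw [Set.indicator_of_mem ht, Set.indicator_of_mem ht]
      module
    · rw [Set.indicator_of_notMem ht, Set.indicator_of_notMem ht, smul_zero]
  rw [hL, hR, integral_sub hint2 hint1, integral_add hint2 hint3, hw, sub_neg_eq_add]

/-- Local approximation by smooth functions: a cut-off `H¹(Ω)` function is mollified with a kernel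
supported in the cone. -/
theorem exists_contDiff_eLpNorm_sub_le (hΩ : IsOpen Ω)
    {u : Lp ℝ 2 (volume.restrict Ω)} {G : Lp (EuclideanSpace ℝ (Fin n)) 2 (volume.restrict Ω)}
    (hu : HasWeakGradient Ω u G) {V : Set (EuclideanSpace ℝ (Fin n))} (hV : IsOpen V)
    (hcone : HasLocalCone Ω V) {χ : EuclideanSpace ℝ (Fin n) → ℝ} (hχ : ContDiff ℝ ∞ χ)
    (hχc : HasCompactSupport χ) (hχV : tsupport χ ⊆ V) {η : ENNReal} (hη : 0 < η) :
    ∃ φ : EuclideanSpace ℝ (Fin n) → ℝ, ContDiff ℝ ∞ φ ∧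
      eLpNorm (fun x => φ x - χ x * u x) 2 (volume.restrict Ω) ≤ η ∧
      eLpNorm (fun x => gradient φ x - (χ x • G x + u x • gradient χ x)) 2
        (volume.restrict Ω) ≤ η := by
  obtain ⟨ν, c, ε₀, hc, hε₀, hcone⟩ := hcone
  have hχg : Continuous (gradient χ) := continuous_gradient_of_contDiff hχ
  have hχgc : HasCompactSupport (gradient χ) :=
    (hχc.fderiv ℝ).comp_left (map_zero (InnerProductSpace.toDual ℝ _).symm)
  obtain ⟨Cχ, hCχ⟩ := hχc.exists_bound_of_continuous hχ.continuous
  obtain ⟨Cg, hCg⟩ := hχgc.exists_bound_of_continuous hχg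
  have hum : StronglyMeasurable u := Lp.stronglyMeasurable u
  have hGm : StronglyMeasurable G := Lp.stronglyMeasurable G
  set f : EuclideanSpace ℝ (Fin n) → ℝ := Ω.indicator fun x => χ x * u x with hf
  set F : EuclideanSpace ℝ (Fin n) → EuclideanSpace ℝ (Fin n) :=
    Ω.indicator fun x => χ x • G x + u x • gradient χ x with hF
  have hfm : StronglyMeasurable f :=
    (hχ.continuous.stronglyMeasurable.mul hum).indicator hΩ.measurableSet
  have hFm : StronglyMeasurable F :=
    ((hχ.continuous.stronglyMeasurable.smul hGm).add
      (hum.smul hχg.stronglyMeasurable)).indicator hΩ.measurableSet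
  have hχtop : MemLp χ ⊤ (volume.restrict Ω) :=
    memLp_top_of_bound hχ.continuous.aestronglyMeasurable Cχ (ae_of_all _ hCχ)
  have hgtop : MemLp (gradient χ) ⊤ (volume.restrict Ω) :=
    memLp_top_of_bound hχg.aestronglyMeasurable Cg (ae_of_all _ hCg)
  have hf2 : MemLp f 2 volume := by
    rw [hf, memLp_indicator_iff_restrict hΩ.measurableSet]
    exact (Lp.memLp u).smul hχtop
  have hF2 : MemLp F 2 volume := by
    rw [hF, memLp_indicator_iff_restrict hΩ.measurableSet]
    exact ((Lp.memLp G).smul hχtop).add (hgtop.smul (Lp.memLp u))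
  obtain ⟨δ₁, hδ₁, h₁⟩ := Metric.eventually_nhds_iff_ball.mp
    ((ENNReal.tendsto_nhds_zero.mp (tendsto_eLpNorm_translate_sub hf2)) η hη)
  obtain ⟨δ₂, hδ₂, h₂⟩ := Metric.eventually_nhds_iff_ball.mp
    ((ENNReal.tendsto_nhds_zero.mp (tendsto_eLpNorm_translate_sub hF2)) η hη)
  obtain ⟨δ₃, hδ₃, h₃⟩ := hχc.isCompact.exists_cthickening_subset_open hV hχV
  -- The kernel will live in the ball of radius `ε * (‖ν‖ + c)` about 0. This radius must be small
  -- for the translation errors of `f` and of `F`, and must not exceed `δ₃`, the distance up to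
  -- which the support of χ may be thickened inside `V`.
  obtain ⟨ε, hε, hεε₀, hε₁, hε₂, hε₃⟩ : ∃ ε > 0, ε ≤ ε₀ ∧ ε * (‖ν‖ + c) < δ₁ ∧
      ε * (‖ν‖ + c) < δ₂ ∧ ε * (‖ν‖ + c) ≤ δ₃ := by
    have hs : 0 < ‖ν‖ + c := by positivity
    refine ⟨min ε₀ (min (δ₁ / 2 / (‖ν‖ + c)) (min (δ₂ / 2 / (‖ν‖ + c)) (δ₃ / (‖ν‖ + c)))),
      by positivity, min_le_left _ _, ?_, ?_, ?_⟩
    · refine lt_of_le_of_lt (b := δ₁ / 2) ?_ (by linarith)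
      rw [← le_div_iff₀ hs]
      exact (min_le_right _ _).trans (min_le_left _ _)
    · refine lt_of_le_of_lt (b := δ₂ / 2) ?_ (by linarith)
      rw [← le_div_iff₀ hs]
      exact (min_le_right _ _).trans ((min_le_right _ _).trans (min_le_left _ _))
    · rw [← le_div_iff₀ hs]
      exact (min_le_right _ _).trans ((min_le_right _ _).trans (min_le_right _ _))
  -- Centring the kernel at -εν means that k(x - t) ≠ 0 forces `t` into the ball of radius cε about
  -- x + εν. By the cone condition that ball lies in `Ω`, so the extension of `u` by zero creates no
  -- boundary term.
  let b : ContDiffBump (-(ε • ν)) := ⟨c * ε / 2, c * ε, by positivity, half_lt_self (by positivity)⟩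
  set k : EuclideanSpace ℝ (Fin n) → ℝ := b.normed volume with hk
  have hks : ContDiff ℝ ∞ k := b.contDiff_normed
  have hkc : HasCompactSupport k := b.hasCompactSupport_normed
  have hksupp : ∀ z ∈ tsupport k, ‖z + ε • ν‖ ≤ c * ε := by
    intro z hz
    rw [hk, b.tsupport_normed_eq, mem_closedBall_iff_norm, sub_neg_eq_add] at hz
    exact hz
  have hknorm : ∀ z ∈ tsupport k, ‖z‖ ≤ ε * (‖ν‖ + c) := by
    intro z hz
    calc ‖z‖ = ‖(z + ε • ν) - ε • ν‖ := by rw [add_sub_cancel_right]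
      _ ≤ ‖z + ε • ν‖ + ‖ε • ν‖ := norm_sub_le _ _
      _ ≤ c * ε + ε * ‖ν‖ := by
          rw [norm_smul, Real.norm_of_nonneg hε.le]
          gcongr
          exact hksupp z hz
      _ = _ := by ring
  have hkz : ∀ z, k z ≠ 0 → z ∈ tsupport k := fun z hz => subset_tsupport k hz
  have hfloc : LocallyIntegrable f volume := hf2.locallyIntegrable (by norm_num)
  obtain ⟨hφs, hφg⟩ := contDiff_and_gradient_integral_mul_comp_sub hfloc hks hkc
  refine ⟨fun x => ∫ t, f t * k (x - t), hφs, ?_, ?_⟩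
  · have h := eLpNorm_average_translate_sub_le hfm hf2 hks.continuous
      (fun z => b.nonneg_normed z) hkc
      (b.integral_normed) (δ := η) fun z hz => h₁ z (by
        rw [mem_ball_zero_iff]
        exact (hknorm z (hkz z hz)).trans_lt hε₁)
    refine le_trans (le_trans (eLpNorm_congr_ae ?_).le (eLpNorm_restrict_le _ _ _ Ω)) h
    filter_upwards [ae_restrict_mem hΩ.measurableSet] with x hx
    have hfx : f x = χ x * u x := by rw [hf, Set.indicator_of_mem hx]
    rw [hfx, ← integral_sub_left_eq_self _ _ x]
    simp [mul_comm]
  · have h := eLpNorm_average_translate_sub_le hFm hF2 hks.continuous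
      (fun z => b.nonneg_normed z) hkc
      (b.integral_normed) (δ := η) fun z hz => h₂ z (by
        rw [mem_ball_zero_iff]
        exact (hknorm z (hkz z hz)).trans_lt hε₂)
    refine le_trans (le_trans (eLpNorm_congr_ae ?_).le (eLpNorm_restrict_le _ _ _ Ω)) h
    filter_upwards [ae_restrict_mem hΩ.measurableSet] with x hx
    have hFx : F x = χ x • G x + u x • gradient χ x := by rw [hF, Set.indicator_of_mem hx]
    rw [hFx, hφg, ← integral_sub_left_eq_self (fun z => k z • F (x - z)) _ x]
    simp only [sub_sub_cancel]
    congr 1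
    have hcs : HasCompactSupport fun t => k (x - t) :=
      hkc.comp_homeomorph (Homeomorph.subLeft x)
    have hksub : ContDiff ℝ ∞ fun t => k (x - t) := hks.comp (contDiff_const.sub contDiff_id)
    have hψ : IsTestFunction Ω fun t => χ t * k (x - t) := by
      refine ⟨hχ.mul hksub, hχc.mul_right, ?_⟩
      intro t ht
      have ht1 : t ∈ tsupport χ := tsupport_mul_subset_left ht
      have ht2 : x - t ∈ tsupport k := by
        have h4 := tsupport_mul_subset_right ht
        exact tsupport_comp_subset_preimage k (by fun_prop : Continuous fun t => x - t) h4
      -- The cone condition is available only over `V`. A point `x` for which the product is not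
      -- identically zero is within δ₃ of the support of χ, hence in `V`.
      have hxV : x ∈ V := by
        apply h₃
        apply Metric.mem_cthickening_of_dist_le x t _ _ ht1
        rw [dist_eq_norm]
        exact (hknorm _ ht2).trans hε₃
      apply hcone x ⟨hx, hxV⟩ ε hε hεε₀
      rw [mem_closedBall_iff_norm']
      have he : x + ε • ν - t = x - t + ε • ν := by abel
      rw [he]
      exact hksupp _ ht2
    exact integral_smul_gradient_comp_sub_eq hΩ hu hχ hχc hks x hψ

theorem gradient_sum {E ι : Type*} [NormedAddCommGroup E] [InnerProductSpace ℝ E]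
    [CompleteSpace E] {s : Finset ι} {φ : ι → E → ℝ} (hφ : ∀ i ∈ s, ContDiff ℝ ∞ (φ i)) (x : E) :
    gradient (fun x => ∑ i ∈ s, φ i x) x = ∑ i ∈ s, gradient (φ i) x := by
  rw [gradient, fderiv_fun_sum fun i hi => ((hφ i hi).differentiable (by simp)).differentiableAt,
    map_sum]
  rfl

/-- Functions smooth up to the boundary are dense in `H¹(Ω)`. -/
theorem IsBoundedLipschitzDomain.exists_contDiff_eLpNorm_sub_le (hΩ : IsBoundedLipschitzDomain Ω)
    {u : Lp ℝ 2 (volume.restrict Ω)} {G : Lp (EuclideanSpace ℝ (Fin n)) 2 (volume.restrict Ω)}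
    (hu : HasWeakGradient Ω u G) {η : ENNReal} (hη : 0 < η) :
    ∃ φ : EuclideanSpace ℝ (Fin n) → ℝ, ContDiff ℝ ∞ φ ∧
      eLpNorm (fun x => φ x - u x) 2 (volume.restrict Ω) ≤ η ∧
      eLpNorm (fun x => gradient φ x - G x) 2 (volume.restrict Ω) ≤ η := by
  choose! r hr hcone using fun x (hx : x ∈ closure Ω) => hΩ.exists_hasLocalCone hx
  obtain ⟨t, htΩ, ht⟩ := hΩ.isCompact_closure.elim_nhds_subcover
    (fun x => Metric.ball x (r x)) fun x hx => Metric.ball_mem_nhds x (hr x hx)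
  obtain ⟨χ, hχsub⟩ := SmoothPartitionOfUnity.exists_isSubordinate
    (modelWithCornersSelf ℝ (EuclideanSpace ℝ (Fin n))) (isClosed_closure (s := Ω))
    (fun x : t => Metric.ball (x : EuclideanSpace ℝ (Fin n)) (r x)) (fun _ => Metric.isOpen_ball)
    (by simpa [Set.iUnion_subtype] using ht)
  have hχs : ∀ i, ContDiff ℝ ∞ (χ i) := fun i => (χ i).contMDiff.contDiff
  have hχc : ∀ i, HasCompactSupport (χ i) := fun i =>
    (isCompact_closedBall (i : EuclideanSpace ℝ (Fin n)) (r i)).of_isClosed_subset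
      (isClosed_tsupport _) ((hχsub i).trans Metric.ball_subset_closedBall)
  have hsum : ∀ x ∈ Ω, ∑ i, χ i x = 1 := fun x hx => by
    rw [← finsum_eq_sum_of_fintype]
    exact χ.sum_eq_one (subset_closure hx)
  -- The partition functions sum to 1 near each point of the open set `Ω`, so the product-rule terms
  -- u ∇χ_i cancel in the sum.
  have hgsum : ∀ x ∈ Ω, ∑ i, gradient (χ i) x = 0 := fun x hx => by
    rw [← gradient_sum fun i _ => hχs i]
    have : (fun x => ∑ i, χ i x) =ᶠ[𝓝 x] fun _ => 1 := by
      filter_upwards [hΩ.isOpen.mem_nhds hx] with y hy using hsum y hy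
    rw [gradient, this.fderiv_eq, fderiv_fun_const, Pi.zero_apply, map_zero]
  set δ : ENNReal := η / (t.card + 1) with hδ
  have hδ0 : 0 < δ := ENNReal.div_pos hη.ne' (by finiteness)
  have hδη : ∑ _i : t, δ ≤ η := by
    rw [Finset.sum_const, Finset.card_univ, Fintype.card_coe, nsmul_eq_mul, hδ, mul_comm]
    calc η / (t.card + 1) * t.card ≤ η / (t.card + 1) * (t.card + 1) := by
          gcongr
          exact le_self_add
      _ = η := ENNReal.div_mul_cancel (by positivity) (by finiteness)
  choose φ hφs hφ hφg using fun i : t => _root_.exists_contDiff_eLpNorm_sub_le hΩ.isOpen hu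
    Metric.isOpen_ball (hcone i (htΩ i i.2)) (hχs i) (hχc i) (hχsub i) hδ0
  have hum : StronglyMeasurable u := Lp.stronglyMeasurable u
  have hGm : StronglyMeasurable G := Lp.stronglyMeasurable G
  refine ⟨fun x => ∑ i, φ i x, ContDiff.sum fun i _ => hφs i, ?_, ?_⟩
  · calc eLpNorm (fun x => (∑ i, φ i x) - u x) 2 (volume.restrict Ω)
        = eLpNorm (∑ i, fun x => φ i x - χ i x * u x) 2 (volume.restrict Ω) := by
          apply eLpNorm_congr_ae
          filter_upwards [ae_restrict_mem hΩ.isOpen.measurableSet] with x hx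
          rw [Finset.sum_apply, Finset.sum_sub_distrib, ← Finset.sum_mul, hsum x hx, one_mul]
      _ ≤ ∑ i, eLpNorm (fun x => φ i x - χ i x * u x) 2 (volume.restrict Ω) :=
          eLpNorm_sum_le (fun i _ => ((hφs i).continuous.stronglyMeasurable.sub
            ((hχs i).continuous.stronglyMeasurable.mul hum)).aestronglyMeasurable) (by norm_num)
      _ ≤ ∑ _i : t, δ := Finset.sum_le_sum fun i _ => hφ i
      _ ≤ η := hδη
  · calc eLpNorm (fun x => gradient (fun x => ∑ i, φ i x) x - G x) 2 (volume.restrict Ω)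
        = eLpNorm (∑ i, fun x => gradient (φ i) x - (χ i x • G x + u x • gradient (χ i) x)) 2
            (volume.restrict Ω) := by
          apply eLpNorm_congr_ae
          filter_upwards [ae_restrict_mem hΩ.isOpen.measurableSet] with x hx
          rw [Finset.sum_apply, Finset.sum_sub_distrib, Finset.sum_add_distrib, ← Finset.sum_smul,
            ← Finset.smul_sum, hsum x hx, hgsum x hx, one_smul, smul_zero, add_zero,
            gradient_sum fun i _ => hφs i]
      _ ≤ ∑ i, eLpNorm (fun x => gradient (φ i) x - (χ i x • G x + u x • gradient (χ i) x)) 2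
            (volume.restrict Ω) :=
          eLpNorm_sum_le (fun i _ =>
            ((continuous_gradient_of_contDiff (hφs i)).stronglyMeasurable.sub
              (((hχs i).continuous.stronglyMeasurable.smul hGm).add
                (hum.smul (continuous_gradient_of_contDiff
                  (hχs i)).stronglyMeasurable))).aestronglyMeasurable) (by norm_num)
      _ ≤ ∑ _i : t, δ := Finset.sum_le_sum fun i _ => hφg i
      _ ≤ η := hδη

end Density

/-! ### The trace operator -/

section Trace

variable {n : ℕ} {Ω : Set (EuclideanSpace ℝ (Fin n))}

theorem IsBoundedLipschitzDomain.exists_eLpNorm_trace_le (hΩ : IsBoundedLipschitzDomain Ω) :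
    ∃ K : NNReal, ∀ φ : EuclideanSpace ℝ (Fin n) → ℝ, ContDiff ℝ ∞ φ →
      eLpNorm φ 2 (surfaceMeasure Ω) ≤ K * (eLpNorm φ 2 (volume.restrict Ω) +
        eLpNorm (gradient φ) 2 (volume.restrict Ω)) := by
  obtain ⟨C, hC⟩ := hΩ.exists_trace_inequality
  -- Passing from squared norms to norms needs only a constant whose square dominates `C`; `C + 1`
  -- serves and avoids a square root.
  refine ⟨C + 1, fun φ hφ => ?_⟩
  rw [eLpNorm_two_le_iff]
  have hen : sobolevEnergy Ω φ = eLpNorm φ 2 (volume.restrict Ω) ^ 2 +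
      eLpNorm (gradient φ) 2 (volume.restrict Ω) ^ 2 := by
    rw [eLpNorm_two_sq, eLpNorm_two_sq, sobolevEnergy]
    exact lintegral_add_left (hφ.continuous.measurable.enorm.pow_const 2) _
  refine (hC φ hφ).trans ?_
  rw [mul_pow, hen]
  gcongr
  · rw [ENNReal.coe_add, ENNReal.coe_one]
    calc (C : ENNReal) ≤ C + 1 := le_self_add
      _ = (C + 1) * 1 := (mul_one _).symm
      _ ≤ (C + 1) * (C + 1) := by
        gcongr
        exact le_add_self
      _ = _ := (sq _).symm
  · rw [add_sq']
    exact le_self_add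

theorem gradient_fun_sub {E : Type*} [NormedAddCommGroup E] [InnerProductSpace ℝ E]
    [CompleteSpace E] {φ ψ : E → ℝ} (hφ : ContDiff ℝ ∞ φ) (hψ : ContDiff ℝ ∞ ψ) (x : E) :
    gradient (fun x => φ x - ψ x) x = gradient φ x - gradient ψ x := by
  rw [gradient, fderiv_fun_sub (hφ.differentiable (by simp)).differentiableAt
    (hψ.differentiable (by simp)).differentiableAt, map_sub]
  rfl

theorem gradient_fun_const_mul {E : Type*} [NormedAddCommGroup E] [InnerProductSpace ℝ E]
    [CompleteSpace E] {φ : E → ℝ} (hφ : ContDiff ℝ ∞ φ) (c : ℝ) (x : E) :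
    gradient (fun x => c * φ x) x = c • gradient φ x := by
  rw [gradient, fderiv_const_mul (hφ.differentiable (by simp)).differentiableAt, map_smul]
  rfl

theorem gradient_fun_add {E : Type*} [NormedAddCommGroup E] [InnerProductSpace ℝ E]
    [CompleteSpace E] {φ ψ : E → ℝ} (hφ : ContDiff ℝ ∞ φ) (hψ : ContDiff ℝ ∞ ψ) (x : E) :
    gradient (fun x => φ x + ψ x) x = gradient φ x + gradient ψ x := by
  rw [gradient, fderiv_fun_add (hφ.differentiable (by simp)).differentiableAt
    (hψ.differentiable (by simp)).differentiableAt, map_add]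
  rfl

theorem tendsto_eLpNorm_add_sub {α F : Type*} [MeasurableSpace α] [NormedAddCommGroup F]
    {μ : Measure α} {a b : ℕ → α → F} {f g h : α → F}
    (ha : ∀ m, AEStronglyMeasurable (a m) μ) (hb : ∀ m, AEStronglyMeasurable (b m) μ)
    (hf : AEStronglyMeasurable f μ) (hg : AEStronglyMeasurable g μ) (hh : h =ᵐ[μ] f + g)
    (haf : Tendsto (fun m => eLpNorm (fun x => a m x - f x) 2 μ) atTop (𝓝 0))
    (hbg : Tendsto (fun m => eLpNorm (fun x => b m x - g x) 2 μ) atTop (𝓝 0)) :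
    Tendsto (fun m => eLpNorm (fun x => a m x + b m x - h x) 2 μ) atTop (𝓝 0) := by
  have h0 := haf.add hbg
  rw [add_zero] at h0
  refine tendsto_of_tendsto_of_tendsto_of_le_of_le tendsto_const_nhds h0 (fun _ => zero_le)
    fun m => ?_
  calc eLpNorm (fun x => a m x + b m x - h x) 2 μ
      = eLpNorm ((fun x => a m x - f x) + fun x => b m x - g x) 2 μ := by
        apply eLpNorm_congr_ae
        filter_upwards [hh] with x hx
        rw [hx, Pi.add_apply, Pi.add_apply]
        abel
    _ ≤ _ := eLpNorm_add_le ((ha m).sub hf) ((hb m).sub hg) (by norm_num)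

theorem tendsto_eLpNorm_const_smul_sub {α F : Type*} [MeasurableSpace α] [NormedAddCommGroup F]
    [NormedSpace ℝ F] {μ : Measure α} {a : ℕ → α → F} {f h : α → F} (c : ℝ)
    (hh : h =ᵐ[μ] c • f)
    (haf : Tendsto (fun m => eLpNorm (fun x => a m x - f x) 2 μ) atTop (𝓝 0)) :
    Tendsto (fun m => eLpNorm (fun x => c • a m x - h x) 2 μ) atTop (𝓝 0) := by
  have h0 := ENNReal.Tendsto.const_mul (a := ‖c‖ₑ) haf (Or.inr (by simp))
  rw [mul_zero] at h0
  refine h0.congr fun m => ?_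
  rw [← eLpNorm_const_smul]
  apply eLpNorm_congr_ae
  filter_upwards [hh] with x hx
  rw [hx, Pi.smul_apply, Pi.smul_apply, smul_sub]

theorem IsTrace.add {u v : sobolevH1 Ω} {f g : BoundaryL2 Ω} (hu : IsTrace u f)
    (hv : IsTrace v g) : IsTrace (u + v) (f + g) := by
  obtain ⟨φ, hφ, h1, h2, h3⟩ := hu
  obtain ⟨ψ, hψ, h1', h2', h3'⟩ := hv
  refine ⟨fun m x => φ m x + ψ m x, fun m => (hφ m).add (hψ m), ?_, ?_, ?_⟩
  · exact tendsto_eLpNorm_add_sub (fun m => (hφ m).continuous.aestronglyMeasurable)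
      (fun m => (hψ m).continuous.aestronglyMeasurable) (Lp.aestronglyMeasurable _)
      (Lp.aestronglyMeasurable _) (Lp.coeFn_add _ _) h1 h1'
  · simp_rw [fun m => gradient_fun_add (hφ m) (hψ m)]
    exact tendsto_eLpNorm_add_sub
      (fun m => (continuous_gradient_of_contDiff (hφ m)).aestronglyMeasurable)
      (fun m => (continuous_gradient_of_contDiff (hψ m)).aestronglyMeasurable)
      (Lp.aestronglyMeasurable _) (Lp.aestronglyMeasurable _) (Lp.coeFn_add _ _) h2 h2'
  · exact tendsto_eLpNorm_add_sub (fun m => (hφ m).continuous.aestronglyMeasurable)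
      (fun m => (hψ m).continuous.aestronglyMeasurable) (Lp.aestronglyMeasurable _)
      (Lp.aestronglyMeasurable _) (Lp.coeFn_add _ _) h3 h3'

theorem IsTrace.const_smul {u : sobolevH1 Ω} {f : BoundaryL2 Ω} (c : ℝ) (hu : IsTrace u f) :
    IsTrace (c • u) (c • f) := by
  obtain ⟨φ, hφ, h1, h2, h3⟩ := hu
  refine ⟨fun m x => c * φ m x, fun m => contDiff_const.mul (hφ m), ?_, ?_, ?_⟩
  · exact tendsto_eLpNorm_const_smul_sub c (Lp.coeFn_smul _ _) h1
  · simp_rw [fun m => gradient_fun_const_mul (hφ m) c]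
    exact tendsto_eLpNorm_const_smul_sub c (Lp.coeFn_smul _ _) h2
  · exact tendsto_eLpNorm_const_smul_sub c (Lp.coeFn_smul _ _) h3

theorem eLpNorm_le_add_sub {α F : Type*} [MeasurableSpace α] [NormedAddCommGroup F]
    {μ : Measure α} {a f : α → F} (ha : AEStronglyMeasurable a μ)
    (hf : AEStronglyMeasurable f μ) :
    eLpNorm a 2 μ ≤ eLpNorm f 2 μ + eLpNorm (fun x => a x - f x) 2 μ := by
  have h : a = f + fun x => a x - f x := by
    ext x
    simp
  conv_lhs => rw [h]
  exact eLpNorm_add_le hf (ha.sub hf) (by norm_num)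

theorem eLpNorm_le_add_sub' {α F : Type*} [MeasurableSpace α] [NormedAddCommGroup F]
    {μ : Measure α} {a f : α → F} (ha : AEStronglyMeasurable a μ)
    (hf : AEStronglyMeasurable f μ) :
    eLpNorm f 2 μ ≤ eLpNorm a 2 μ + eLpNorm (fun x => a x - f x) 2 μ := by
  have h : (fun x => a x - f x) = a - f := rfl
  rw [h, eLpNorm_sub_comm]
  exact eLpNorm_le_add_sub hf ha

/-- The trace inequality for the approximating smooth functions passes to the limit. The bound makes
`IsTrace` single-valued and the trace operator continuous. -/
theorem IsBoundedLipschitzDomain.exists_norm_le_of_isTrace (hΩ : IsBoundedLipschitzDomain Ω) :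
    ∃ K : NNReal, ∀ (u : sobolevH1 Ω) (f : BoundaryL2 Ω), IsTrace u f → ‖f‖ ≤ K * ‖u‖ := by
  obtain ⟨K, hK⟩ := hΩ.exists_eLpNorm_trace_le
  refine ⟨K * 2, fun u f ⟨φ, hφ, h1, h2, h3⟩ => ?_⟩
  have hle : eLpNorm f 2 (surfaceMeasure Ω) ≤ K *
      (eLpNorm (sobolevVal u) 2 (volume.restrict Ω) +
        eLpNorm (sobolevGrad u) 2 (volume.restrict Ω)) := by
    have hlim : Tendsto (fun m => K *
        ((eLpNorm (sobolevVal u) 2 (volume.restrict Ω) +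
            eLpNorm (fun x => φ m x - sobolevVal u x) 2 (volume.restrict Ω)) +
          (eLpNorm (sobolevGrad u) 2 (volume.restrict Ω) +
            eLpNorm (fun x => gradient (φ m) x - sobolevGrad u x) 2 (volume.restrict Ω))) +
        eLpNorm (fun x => φ m x - f x) 2 (surfaceMeasure Ω)) atTop
        (𝓝 (K * ((eLpNorm (sobolevVal u) 2 (volume.restrict Ω) + 0) +
          (eLpNorm (sobolevGrad u) 2 (volume.restrict Ω) + 0)) + 0)) :=
      (ENNReal.Tendsto.const_mul ((tendsto_const_nhds.add h1).add (tendsto_const_nhds.add h2))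
        (Or.inr ENNReal.coe_ne_top)).add h3
    simp only [add_zero] at hlim
    refine ge_of_tendsto' hlim fun m => ?_
    calc eLpNorm f 2 (surfaceMeasure Ω)
        ≤ eLpNorm (φ m) 2 (surfaceMeasure Ω) +
            eLpNorm (fun x => φ m x - f x) 2 (surfaceMeasure Ω) :=
          eLpNorm_le_add_sub' (hφ m).continuous.aestronglyMeasurable (Lp.aestronglyMeasurable _)
      _ ≤ _ := by
          gcongr
          refine (hK _ (hφ m)).trans ?_
          gcongr
          · exact eLpNorm_le_add_sub (hφ m).continuous.aestronglyMeasurable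
              (Lp.aestronglyMeasurable _)
          · exact eLpNorm_le_add_sub
              (continuous_gradient_of_contDiff (hφ m)).aestronglyMeasurable
              (Lp.aestronglyMeasurable _)
  rw [← Lp.enorm_def, ← Lp.enorm_def, ← Lp.enorm_def] at hle
  have hle' : ‖f‖ ≤ K * (‖sobolevVal u‖ + ‖sobolevGrad u‖) := by
    simp only [enorm_eq_nnnorm] at hle
    exact_mod_cast hle
  have h4 : ‖sobolevVal u‖ ≤ ‖u‖ := WithLp.norm_fst_le _ _
  have h5 : ‖sobolevGrad u‖ ≤ ‖u‖ := WithLp.norm_snd_le _ _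
  calc ‖f‖ ≤ K * (‖sobolevVal u‖ + ‖sobolevGrad u‖) := hle'
    _ ≤ K * (‖u‖ + ‖u‖) := by gcongr
    _ = _ := by push_cast; ring

/-- `IsTrace` is a linear relation, so `f - g` is a trace of 0 and the norm bound kills it. -/
theorem IsBoundedLipschitzDomain.isTrace_unique (hΩ : IsBoundedLipschitzDomain Ω)
    {u : sobolevH1 Ω} {f g : BoundaryL2 Ω} (hf : IsTrace u f) (hg : IsTrace u g) : f = g := by
  obtain ⟨K, hK⟩ := hΩ.exists_norm_le_of_isTrace
  have h := hK _ _ (hf.add (hg.const_smul (-1)))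
  rw [neg_one_smul, neg_one_smul, add_neg_cancel, norm_zero, mul_zero, ← sub_eq_add_neg] at h
  exact sub_eq_zero.mp (norm_le_zero_iff.mp h)

/-- Smooth approximants with H¹ error of order 2⁻ᵐ have boundary values that form a Cauchy sequence,
by the trace inequality applied to consecutive differences. -/
theorem IsBoundedLipschitzDomain.exists_isTrace (hΩ : IsBoundedLipschitzDomain Ω)
    (u : sobolevH1 Ω) : ∃ f : BoundaryL2 Ω, IsTrace u f := by
  obtain ⟨K, hK⟩ := hΩ.exists_eLpNorm_trace_le
  have hη : ∀ m : ℕ, (0 : ENNReal) < (2 ^ m)⁻¹ := fun m => by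
    simp
  choose φ hφ h1 h2 using fun m : ℕ =>
    hΩ.exists_contDiff_eLpNorm_sub_le (u := sobolevVal u) (G := sobolevGrad u) u.2 (hη m)
  have hum := Lp.aestronglyMeasurable (sobolevVal u)
  have hGm := Lp.aestronglyMeasurable (sobolevGrad u)
  have hgm : ∀ m, AEStronglyMeasurable (gradient (φ m)) (volume.restrict Ω) := fun m =>
    (continuous_gradient_of_contDiff (hφ m)).aestronglyMeasurable
  have hφm : ∀ (μ : Measure (EuclideanSpace ℝ (Fin n))) m, AEStronglyMeasurable (φ m) μ :=
    fun μ m => (hφ m).continuous.aestronglyMeasurable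
  have hη0 : Tendsto (fun m : ℕ => ((2 : ENNReal) ^ m)⁻¹) atTop (𝓝 0) := by
    simp_rw [ENNReal.inv_pow]
    exact ENNReal.tendsto_pow_atTop_nhds_zero_of_lt_one (by simp)
  have hmem : ∀ m, MemLp (φ m) 2 (surfaceMeasure Ω) := fun m => by
    refine ⟨hφm _ m, (hK _ (hφ m)).trans_lt ?_⟩
    have h3 := (eLpNorm_le_add_sub (hφm _ m) hum).trans (add_le_add_right (h1 m) _)
    have h4 := (eLpNorm_le_add_sub (hgm m) hGm).trans (add_le_add_right (h2 m) _)
    have h5 := (Lp.memLp (sobolevVal u)).2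
    have h6 := (Lp.memLp (sobolevGrad u)).2
    have h7 : ((2 : ENNReal) ^ m)⁻¹ < ⊤ := ENNReal.inv_lt_top.mpr (by positivity)
    refine ENNReal.mul_lt_top ENNReal.coe_lt_top (ENNReal.add_lt_top.mpr ⟨?_, ?_⟩)
    · exact h3.trans_lt (ENNReal.add_lt_top.mpr ⟨h5, h7⟩)
    · exact h4.trans_lt (ENNReal.add_lt_top.mpr ⟨h6, h7⟩)
  have hcauchy : CauchySeq fun m => (hmem m).toLp (φ m) := by
    refine cauchySeq_of_edist_le_geometric_two (4 * K) (by finiteness) fun m => ?_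
    rw [Lp.edist_toLp_toLp]
    have hsub : eLpNorm (φ m - φ (m + 1)) 2 (surfaceMeasure Ω) ≤ K *
        (eLpNorm (fun x => φ m x - φ (m + 1) x) 2 (volume.restrict Ω) +
          eLpNorm (gradient fun x => φ m x - φ (m + 1) x) 2 (volume.restrict Ω)) :=
      hK _ ((hφ m).sub (hφ (m + 1)))
    have hmono : ((2 : ENNReal) ^ (m + 1))⁻¹ ≤ (2 ^ m)⁻¹ := by
      gcongr
      · norm_num
      · exact Nat.le_succ m
    have h3 : eLpNorm (fun x => φ m x - φ (m + 1) x) 2 (volume.restrict Ω) ≤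
        (2 ^ m)⁻¹ + (2 ^ m)⁻¹ := by
      have he : (fun x => φ m x - φ (m + 1) x) =
          (fun x => φ m x - sobolevVal u x) - fun x => φ (m + 1) x - sobolevVal u x := by
        ext x
        simp
      rw [he]
      exact (eLpNorm_sub_le ((hφm _ m).sub hum) ((hφm _ _).sub hum) (by norm_num)).trans
        (add_le_add (h1 m) ((h1 (m + 1)).trans hmono))
    have h4 : eLpNorm (gradient fun x => φ m x - φ (m + 1) x) 2 (volume.restrict Ω) ≤
        (2 ^ m)⁻¹ + (2 ^ m)⁻¹ := by
      have he : (gradient fun x => φ m x - φ (m + 1) x) =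
          (fun x => gradient (φ m) x - sobolevGrad u x) -
            fun x => gradient (φ (m + 1)) x - sobolevGrad u x := by
        ext1 x
        rw [gradient_fun_sub (hφ m) (hφ (m + 1)), Pi.sub_apply]
        abel
      rw [he]
      exact (eLpNorm_sub_le ((hgm m).sub hGm) ((hgm _).sub hGm) (by norm_num)).trans
        (add_le_add (h2 m) ((h2 (m + 1)).trans hmono))
    refine hsub.trans ((mul_le_mul' le_rfl (add_le_add h3 h4)).trans_eq ?_)
    rw [div_eq_mul_inv]
    ring
  obtain ⟨f, hf⟩ := cauchySeq_tendsto_of_complete hcauchy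
  refine ⟨f, φ, hφ, ?_, ?_, ?_⟩
  · exact tendsto_of_tendsto_of_tendsto_of_le_of_le tendsto_const_nhds hη0 (fun _ => zero_le) h1
  · exact tendsto_of_tendsto_of_tendsto_of_le_of_le tendsto_const_nhds hη0 (fun _ => zero_le) h2
  · have h3 := tendsto_iff_edist_tendsto_0.mp hf
    refine h3.congr fun m => ?_
    rw [Lp.edist_def]
    apply eLpNorm_congr_ae
    filter_upwards [(hmem m).coeFn_toLp] with x hx
    rw [Pi.sub_apply, hx]

/-- The trace operator `H¹(Ω) → L²(∂Ω)`. -/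
noncomputable def traceOp (hΩ : IsBoundedLipschitzDomain Ω) : sobolevH1 Ω →L[ℝ] BoundaryL2 Ω :=
  LinearMap.mkContinuous
    { toFun := fun u => (hΩ.exists_isTrace u).choose
      map_add' := fun u v => hΩ.isTrace_unique (hΩ.exists_isTrace (u + v)).choose_spec
        ((hΩ.exists_isTrace u).choose_spec.add (hΩ.exists_isTrace v).choose_spec)
      map_smul' := fun c u => hΩ.isTrace_unique (hΩ.exists_isTrace (c • u)).choose_spec
        ((hΩ.exists_isTrace u).choose_spec.const_smul c) }
    hΩ.exists_norm_le_of_isTrace.choose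
    fun u => hΩ.exists_norm_le_of_isTrace.choose_spec u _ (hΩ.exists_isTrace u).choose_spec

theorem isTrace_iff_eq_traceOp (hΩ : IsBoundedLipschitzDomain Ω) {u : sobolevH1 Ω}
    {f : BoundaryL2 Ω} : IsTrace u f ↔ f = traceOp hΩ u := by
  have h : IsTrace u (traceOp hΩ u) := (hΩ.exists_isTrace u).choose_spec
  exact ⟨fun hf => hΩ.isTrace_unique hf h, fun hf => hf ▸ h⟩

end Trace

/-! ### Completeness, separability and Rellich's theorem -/

section Sobolev

variable {n : ℕ} {Ω : Set (EuclideanSpace ℝ (Fin n))}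

/-- Each test function imposes an equality between two continuous functions of (u, G), because
pairing with a fixed L² function is continuous. -/
theorem isClosed_sobolevH1 : IsClosed (sobolevH1 Ω : Set (WithLp 2 (Lp ℝ 2 (volume.restrict Ω) ×
    Lp (EuclideanSpace ℝ (Fin n)) 2 (volume.restrict Ω)))) := by
  have hset : (sobolevH1 Ω : Set (WithLp 2 (Lp ℝ 2 (volume.restrict Ω) ×
      Lp (EuclideanSpace ℝ (Fin n)) 2 (volume.restrict Ω)))) =
      ⋂ φ ∈ {φ | IsTestFunction Ω φ}, {p | ∫ x in Ω, p.fst x • gradient φ x =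
        - ∫ x in Ω, φ x • p.snd x} := by
    ext p
    simp only [Set.mem_iInter]
    rfl
  rw [hset]
  refine isClosed_biInter fun φ hφ => ?_
  have hφ2 : MemLp φ 2 (volume.restrict Ω) :=
    hφ.contDiff.continuous.memLp_of_hasCompactSupport hφ.hasCompactSupport
  have hg2 : MemLp (gradient φ) 2 (volume.restrict Ω) :=
    hφ.continuous_gradient.memLp_of_hasCompactSupport hφ.hasCompactSupport_gradient
  let B : ℝ →L[ℝ] EuclideanSpace ℝ (Fin n) →L[ℝ] EuclideanSpace ℝ (Fin n) :=
    ContinuousLinearMap.lsmul ℝ ℝ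
  have h1 : ∀ u : Lp ℝ 2 (volume.restrict Ω), ∫ x in Ω, u x • gradient φ x =
      B.lpPairing (volume.restrict Ω) 2 2 u (hg2.toLp _) := fun u => by
    rw [ContinuousLinearMap.lpPairing_eq_integral]
    apply integral_congr_ae
    filter_upwards [hg2.coeFn_toLp] with x hx
    rw [hx]
    rfl
  have h2 : ∀ G : Lp (EuclideanSpace ℝ (Fin n)) 2 (volume.restrict Ω), ∫ x in Ω, φ x • G x =
      B.lpPairing (volume.restrict Ω) 2 2 (hφ2.toLp _) G := fun G => by
    rw [ContinuousLinearMap.lpPairing_eq_integral]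
    apply integral_congr_ae
    filter_upwards [hφ2.coeFn_toLp] with x hx
    rw [hx]
    rfl
  simp_rw [h1, h2]
  have hfst := WithLp.prod_continuous_ofLp 2 (Lp ℝ 2 (volume.restrict Ω))
    (Lp (EuclideanSpace ℝ (Fin n)) 2 (volume.restrict Ω))
  apply isClosed_eq
  · exact ((B.lpPairing (volume.restrict Ω) 2 2).flip (hg2.toLp _)).continuous.comp
      (continuous_fst.comp hfst)
  · exact ((B.lpPairing (volume.restrict Ω) 2 2 (hφ2.toLp _)).continuous.comp
      (continuous_snd.comp hfst)).neg

instance : CompleteSpace (sobolevH1 Ω) := isClosed_sobolevH1.completeSpace_coe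

instance : SecondCountableTopology (sobolevH1 Ω) := by
  have : Fact ((2 : ENNReal) ≠ ⊤) := ⟨by simp⟩
  have h1 : SecondCountableTopology (Lp ℝ 2 (volume.restrict Ω)) := Lp.SecondCountableTopology
  have h2 : SecondCountableTopology (Lp (EuclideanSpace ℝ (Fin n)) 2 (volume.restrict Ω)) :=
    Lp.SecondCountableTopology
  have h3 : SecondCountableTopology (WithLp 2 (Lp ℝ 2 (volume.restrict Ω) ×
      Lp (EuclideanSpace ℝ (Fin n)) 2 (volume.restrict Ω))) :=
    (WithLp.homeomorphProd 2 _ _).secondCountableTopology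
  exact TopologicalSpace.Subtype.secondCountableTopology _

/-- The embedding `H¹(Ω) → L²(Ω)`. -/
noncomputable def sobolevEmbedding (Ω : Set (EuclideanSpace ℝ (Fin n))) :
    sobolevH1 Ω →L[ℝ] Lp ℝ 2 (volume.restrict Ω) :=
  (ContinuousLinearMap.fst ℝ _ _).comp
    ((WithLp.prodContinuousLinearEquiv 2 ℝ (Lp ℝ 2 (volume.restrict Ω))
      (Lp (EuclideanSpace ℝ (Fin n)) 2 (volume.restrict Ω))).toContinuousLinearMap.comp
        (sobolevH1 Ω).subtypeL)

theorem sobolevEmbedding_apply (u : sobolevH1 Ω) : sobolevEmbedding Ω u = sobolevVal u := rfl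

/-- Rellich's theorem: the embedding `H¹(Ω) → L²(Ω)` maps bounded weakly null sequences to null
sequences. -/
theorem IsBoundedLipschitzDomain.tendsto_sobolevEmbedding (hΩ : IsBoundedLipschitzDomain Ω)
    {u : ℕ → sobolevH1 Ω} {M : ℝ} (hM : ∀ m, ‖u m‖ ≤ M)
    (hu : ∀ v : sobolevH1 Ω, Tendsto (fun m => inner ℝ v (u m)) atTop (𝓝 0)) :
    Tendsto (fun m => sobolevEmbedding Ω (u m)) atTop (𝓝 0) := by
  have hM0 : 0 ≤ M := (norm_nonneg _).trans (hM 0)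
  have hη : ∀ m : ℕ, (0 : ENNReal) < (2 ^ m)⁻¹ := fun m => by
    simp
  have hη0 : Tendsto (fun m : ℕ => ((2 : ENNReal) ^ m)⁻¹) atTop (𝓝 0) := by
    simp_rw [ENNReal.inv_pow]
    exact ENNReal.tendsto_pow_atTop_nhds_zero_of_lt_one (by simp)
  have hη1 : ∀ m : ℕ, ((2 : ENNReal) ^ m)⁻¹ ≤ 1 := fun m => by
    rw [ENNReal.inv_le_one]
    exact one_le_pow₀ (by norm_num)
  choose φ hφ h1 h2 using fun m : ℕ => hΩ.exists_contDiff_eLpNorm_sub_le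
    (u := sobolevVal (u m)) (G := sobolevGrad (u m)) (u m).2 (hη m)
  have hum := fun m => Lp.aestronglyMeasurable (sobolevVal (u m))
  have hGm := fun m => Lp.aestronglyMeasurable (sobolevGrad (u m))
  have hgm : ∀ m, AEStronglyMeasurable (gradient (φ m)) (volume.restrict Ω) := fun m =>
    (continuous_gradient_of_contDiff (hφ m)).aestronglyMeasurable
  have hφm : ∀ (μ : Measure (EuclideanSpace ℝ (Fin n))) m, AEStronglyMeasurable (φ m) μ :=
    fun μ m => (hφ m).continuous.aestronglyMeasurable
  have hb1 : ∀ m, eLpNorm (sobolevVal (u m)) 2 (volume.restrict Ω) ≤ ENNReal.ofReal M := fun m => by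
    rw [← Lp.enorm_def, ← ofReal_norm]
    exact ENNReal.ofReal_le_ofReal ((WithLp.norm_fst_le _ _).trans (hM m))
  have hb2 : ∀ m, eLpNorm (sobolevGrad (u m)) 2 (volume.restrict Ω) ≤
      ENNReal.ofReal M := fun m => by
    rw [← Lp.enorm_def, ← ofReal_norm]
    exact ENNReal.ofReal_le_ofReal ((WithLp.norm_snd_le _ _).trans (hM m))
  have hen : ∀ m, sobolevEnergy Ω (φ m) ≤
      ((M.toNNReal + 1) ^ 2 + (M.toNNReal + 1) ^ 2 : NNReal) := by
    intro m
    have h3 := (eLpNorm_le_add_sub (hφm _ m) (hum m)).trans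
      (add_le_add (hb1 m) ((h1 m).trans (hη1 m)))
    have h4 := (eLpNorm_le_add_sub (hgm m) (hGm m)).trans
      (add_le_add (hb2 m) ((h2 m).trans (hη1 m)))
    calc sobolevEnergy Ω (φ m) = eLpNorm (φ m) 2 (volume.restrict Ω) ^ 2 +
          eLpNorm (gradient (φ m)) 2 (volume.restrict Ω) ^ 2 := by
          rw [eLpNorm_two_sq, eLpNorm_two_sq, sobolevEnergy]
          exact lintegral_add_left ((hφ m).continuous.measurable.enorm.pow_const 2) _
      _ ≤ (ENNReal.ofReal M + 1) ^ 2 + (ENNReal.ofReal M + 1) ^ 2 := by gcongr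
      _ = _ := by
          push_cast
          rfl
  have hball : ∀ x ρ, Metric.closedBall x ρ ⊆ Ω →
      Tendsto (fun m => ∫ y in Metric.closedBall x ρ, φ m y) atTop (𝓝 0) := by
    intro x ρ hx
    set B := Metric.closedBall x ρ with hB
    have hBt : volume B ≠ ⊤ := (isCompact_closedBall _ _).measure_ne_top
    have hBm : MeasurableSet B := measurableSet_closedBall
    have hBr : (volume.restrict Ω) B ≠ ⊤ :=
      ((Measure.restrict_apply_le _ _).trans_lt hBt.lt_top).ne
    have hres : (volume.restrict Ω).restrict B = volume.restrict B := by
      rw [Measure.restrict_restrict hBm, Set.inter_eq_self_of_subset_left hx]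
    have hlim1 : Tendsto (fun m => ∫ y in B, sobolevVal (u m) y) atTop (𝓝 0) := by
      -- The integral over `B` is the pairing with the indicator of `B`; its image under J* is the
      -- vector against which weak convergence is tested.
      have h3 := hu ((ContinuousLinearMap.adjoint (sobolevEmbedding Ω))
        (indicatorConstLp 2 hBm hBr (1 : ℝ)))
      refine h3.congr fun m => ?_
      rw [ContinuousLinearMap.adjoint_inner_left, L2.inner_indicatorConstLp_one, hres]
      rfl
    have hle : volume.restrict B ≤ volume.restrict Ω := Measure.restrict_mono hx le_rfl
    have hint1 : ∀ m, Integrable (φ m) (volume.restrict B) := fun m =>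
      (hφ m).continuous.continuousOn.integrableOn_compact (isCompact_closedBall _ _)
    have : IsFiniteMeasure (volume.restrict B) := ⟨by simpa using hBt.lt_top⟩
    have hint2 : ∀ m, Integrable (sobolevVal (u m)) (volume.restrict B) := fun m =>
      ((Lp.memLp (sobolevVal (u m))).mono_measure hle).integrable (by norm_num)
    -- By Cauchy–Schwarz on `B`, replacing `u m` by its smooth approximant changes the integral by
    -- at most |B|^(1/2) 2⁻ᵐ.
    have hlim2 : Tendsto (fun m => ∫ y in B, (φ m y - sobolevVal (u m) y)) atTop (𝓝 0) := by
      rw [tendsto_zero_iff_enorm_tendsto_zero]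
      have h4 : Tendsto (fun m : ℕ => (volume B) ^ (1 / 2 : ℝ) * ((2 : ENNReal) ^ m)⁻¹)
            atTop (𝓝 0) := by
        have := ENNReal.Tendsto.const_mul (a := (volume B) ^ (1 / 2 : ℝ)) hη0
          (Or.inr (by finiteness))
        rwa [mul_zero] at this
      refine tendsto_of_tendsto_of_tendsto_of_le_of_le tendsto_const_nhds h4 (fun _ => zero_le)
        fun m => ?_
      rw [← ENNReal.pow_le_pow_left_iff two_ne_zero]
      calc ‖∫ y in B, (φ m y - sobolevVal (u m) y)‖ₑ ^ 2
          ≤ volume B * ∫⁻ y in B, ‖φ m y - sobolevVal (u m) y‖ₑ ^ 2 := by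
            have := enorm_integral_sq_le ((hint1 m).sub (hint2 m)).aestronglyMeasurable
            rwa [Measure.restrict_apply_univ] at this
        _ ≤ volume B * ((2 ^ m)⁻¹) ^ 2 := by
            gcongr
            exact (lintegral_mono' hle le_rfl).trans (eLpNorm_two_le_iff.mp (h1 m))
        _ = _ := by
            rw [mul_pow, ← ENNReal.rpow_natCast (volume B ^ _), ← ENNReal.rpow_mul]
            norm_num
    have h5 := hlim2.add hlim1
    rw [add_zero] at h5
    refine h5.congr fun m => ?_
    rw [integral_sub (hint1 m) (hint2 m), sub_add_cancel]
  have hR := hΩ.tendsto_lintegral_sq_of_tendsto_ball hφ hen hball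
  have hR' : Tendsto (fun m => eLpNorm (φ m) 2 (volume.restrict Ω)) atTop (𝓝 0) := by
    simp_rw [← eLpNorm_two_sq] at hR
    have h6 := (ENNReal.continuous_rpow_const (y := 1 / 2)).tendsto 0 |>.comp hR
    simp only [Function.comp_def, ← ENNReal.rpow_natCast, ← ENNReal.rpow_mul] at h6
    simpa using h6
  rw [tendsto_zero_iff_enorm_tendsto_zero]
  have h7 := hR'.add hη0
  rw [add_zero] at h7
  refine tendsto_of_tendsto_of_tendsto_of_le_of_le tendsto_const_nhds h7 (fun _ => zero_le)
    fun m => ?_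
  rw [Lp.enorm_def]
  exact (eLpNorm_le_add_sub' (hφm _ m) (hum m)).trans (add_le_add le_rfl (h1 m))

end Sobolev

/-! ### The abstract problem on Hilbert spaces -/

/-- The bounded linear map `T ↦ P ∘ T ∘ Q` between spaces of operators. -/
noncomputable def sandwichCLM {E F G K : Type*} [NormedAddCommGroup E] [NormedSpace ℝ E]
    [NormedAddCommGroup F] [NormedSpace ℝ F] [NormedAddCommGroup G] [NormedSpace ℝ G]
    [NormedAddCommGroup K] [NormedSpace ℝ K] (P : G →L[ℝ] K) (Q : E →L[ℝ] F) :
    (F →L[ℝ] G) →L[ℝ] (E →L[ℝ] K) :=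
  (ContinuousLinearMap.compL ℝ E G K P).comp ((ContinuousLinearMap.compL ℝ E F G).flip Q)

theorem sandwichCLM_apply {E F G K : Type*} [NormedAddCommGroup E] [NormedSpace ℝ E]
    [NormedAddCommGroup F] [NormedSpace ℝ F] [NormedAddCommGroup G] [NormedSpace ℝ G]
    [NormedAddCommGroup K] [NormedSpace ℝ K] (P : G →L[ℝ] K) (Q : E →L[ℝ] F) (T : F →L[ℝ] G) :
    sandwichCLM P Q T = P.comp (T.comp Q) := rfl

section Hilbert

variable {H Y : Type*} [NormedAddCommGroup H] [InnerProductSpace ℝ H] [CompleteSpace H]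
  [NormedAddCommGroup Y] [InnerProductSpace ℝ Y] [CompleteSpace Y]

/-- Sequential Banach–Alaoglu in the dual, where separability is used, transported to `H` by the
Riesz isomorphism. -/
theorem exists_weakly_convergent_subseq [TopologicalSpace.SeparableSpace H] {u : ℕ → H} {M : ℝ}
    (hu : ∀ m, ‖u m‖ ≤ M) :
    ∃ (a : H) (φ : ℕ → ℕ), StrictMono φ ∧
      ∀ v : H, Tendsto (fun m => inner ℝ v (u (φ m))) atTop (𝓝 (inner ℝ v a)) := by
  let x : ℕ → WeakDual ℝ H := fun m => StrongDual.toWeakDual (InnerProductSpace.toDual ℝ H (u m))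
  have hx : ∀ m, x m ∈ WeakDual.toStrongDual ⁻¹' Metric.closedBall (0 : StrongDual ℝ H) M := by
    intro m
    rw [Set.mem_preimage, mem_closedBall_zero_iff]
    change ‖InnerProductSpace.toDual ℝ H (u m)‖ ≤ M
    rw [LinearIsometryEquiv.norm_map]
    exact hu m
  obtain ⟨a, -, φ, hφ, hlim⟩ := WeakDual.isSeqCompact_closedBall ℝ H 0 M hx
  refine ⟨(InnerProductSpace.toDual ℝ H).symm (WeakDual.toStrongDual a), φ, hφ, fun v => ?_⟩
  have h := ((WeakDual.eval_continuous v).tendsto a).comp hlim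
  rw [real_inner_comm, InnerProductSpace.toDual_symm_apply]
  refine h.congr fun m => ?_
  rw [real_inner_comm]
  rfl

/-- Fredholm alternative for a self-adjoint operator `1 - J* S J` on a separable Hilbert space,
where `J` maps bounded weakly null sequences to null sequences. -/
theorem isUnit_one_sub_of_injective [TopologicalSpace.SeparableSpace H] (J : H →L[ℝ] Y)
    (hJ : ∀ (u : ℕ → H) (M : ℝ), (∀ m, ‖u m‖ ≤ M) →
      (∀ v, Tendsto (fun m => inner ℝ v (u m)) atTop (𝓝 0)) →
      Tendsto (fun m => J (u m)) atTop (𝓝 0))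
    (S : Y →L[ℝ] Y) {A : H →L[ℝ] H}
    (hA : ∀ x y : H, inner ℝ (A x) y = (inner ℝ x y - inner ℝ (S (J x)) (J y) : ℝ))
    (hsa : IsSelfAdjoint A) (hker : ∀ x, A x = 0 → x = 0) : IsUnit A := by
  have hsym : ∀ x y, inner ℝ (A x) y = inner ℝ x (A y) :=
    ContinuousLinearMap.isSelfAdjoint_iff_isSymmetric.mp hsa
  -- Otherwise there are unit vectors with A x → 0. A weak limit of a subsequence lies in the
  -- kernel, hence is 0, so J x → 0; then 1 = ‖x‖² = ⟨A x, x⟩ + ⟨S J x, J x⟩ tends to 0, a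
  -- contradiction.
  obtain ⟨c, hc, hbound⟩ : ∃ c : ℝ, 0 < c ∧ ∀ x, c * ‖x‖ ≤ ‖A x‖ := by
    by_contra! hcon
    have hex : ∀ m : ℕ, ∃ x, ‖x‖ = 1 ∧ ‖A x‖ ≤ 1 / (m + 1) := by
      intro m
      obtain ⟨x, hx⟩ := hcon (1 / (m + 1)) (by positivity)
      have hx0 : 0 < ‖x‖ := by
        by_contra! h0
        have : x = 0 := norm_le_zero_iff.mp h0
        simp [this] at hx
      refine ⟨‖x‖⁻¹ • x, ?_, ?_⟩
      · rw [norm_smul, norm_inv, norm_norm, inv_mul_cancel₀ hx0.ne']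
      · rw [map_smul, norm_smul, norm_inv, norm_norm, inv_mul_le_iff₀ hx0, mul_comm]
        exact hx.le
    choose x hx1 hxA using hex
    have hA0 : Tendsto (fun m => A (x m)) atTop (𝓝 0) :=
      squeeze_zero_norm hxA tendsto_one_div_add_atTop_nhds_zero_nat
    obtain ⟨a, φ, hφ, hlim⟩ := exists_weakly_convergent_subseq (fun m => (hx1 m).le)
    have hA0' : Tendsto (fun m => A (x (φ m))) atTop (𝓝 0) := hA0.comp hφ.tendsto_atTop
    have ha : a = 0 := by
      apply hker
      refine ext_inner_left ℝ fun v => ?_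
      rw [inner_zero_right, ← hsym]
      refine tendsto_nhds_unique (hlim (A v)) ?_
      simp_rw [hsym v]
      simpa using (tendsto_const_nhds (x := v)).inner hA0'
    have hJ0 : Tendsto (fun m => J (x (φ m))) atTop (𝓝 0) :=
      hJ _ 1 (fun m => (hx1 _).le) fun v => by simpa [ha] using hlim v
    have h1 : Tendsto (fun m => (inner ℝ (S (J (x (φ m)))) (J (x (φ m))) : ℝ)) atTop (𝓝 0) := by
      simpa using Filter.Tendsto.inner (𝕜 := ℝ) ((S.continuous.tendsto 0).comp hJ0) hJ0
    have h2 : Tendsto (fun m => inner ℝ (A (x (φ m))) (x (φ m))) atTop (𝓝 0) := by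
      refine squeeze_zero_norm (fun m => ?_) (tendsto_zero_iff_norm_tendsto_zero.mp hA0')
      refine (norm_inner_le_norm _ _).trans_eq ?_
      rw [hx1, mul_one]
    have h3 := h2.add h1
    rw [add_zero] at h3
    have h4 : (fun m => inner ℝ (A (x (φ m))) (x (φ m)) +
        inner ℝ (S (J (x (φ m)))) (J (x (φ m)))) = fun _ => (1 : ℝ) := by
      ext m
      rw [hA, sub_add_cancel, real_inner_self_eq_norm_sq, hx1, one_pow]
    rw [h4] at h3
    exact one_ne_zero (tendsto_nhds_unique tendsto_const_nhds h3)
  have hanti : AntilipschitzWith (Real.toNNReal c⁻¹) A := by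
    apply ContinuousLinearMap.antilipschitz_of_bound
    intro x
    rw [Real.coe_toNNReal _ (by positivity), inv_mul_eq_div, le_div_iff₀ hc, mul_comm]
    exact hbound x
  have hclosed : IsClosed (LinearMap.range A.toLinearMap : Set H) :=
    hanti.isClosed_range A.uniformContinuous
  -- The range is closed by the lower bound, and its orthogonal complement is the kernel of the
  -- self-adjoint `A`, which is trivial.
  have hrange : LinearMap.range A.toLinearMap = ⊤ := by
    have : CompleteSpace (LinearMap.range A.toLinearMap) := hclosed.completeSpace_coe
    rw [← Submodule.orthogonal_eq_bot_iff, Submodule.eq_bot_iff]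
    intro y hy
    apply hker
    refine ext_inner_left ℝ fun v => ?_
    rw [inner_zero_right, ← hsym]
    exact hy (A v) ⟨v, rfl⟩
  rw [ContinuousLinearMap.isUnit_iff_bijective]
  exact ⟨hanti.injective, LinearMap.range_eq_top.mp hrange⟩

variable {B Q : Type*} [NormedAddCommGroup B] [InnerProductSpace ℝ B] [CompleteSpace B]
  [NormedAddCommGroup Q] [NormedSpace ℝ Q]

/-- The operator `1 - J* J - c J* M(q) J`. -/
noncomputable def formOp (J : H →L[ℝ] Y) (M : Q →L[ℝ] Y →L[ℝ] Y) (c : ℝ) (q : Q) : H →L[ℝ] H :=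
  1 - (ContinuousLinearMap.adjoint J).comp J -
    c • sandwichCLM (ContinuousLinearMap.adjoint J) J (M q)

theorem inner_formOp (J : H →L[ℝ] Y) (M : Q →L[ℝ] Y →L[ℝ] Y) (c : ℝ) (q : Q) (u v : H) :
    inner ℝ (formOp J M c q u) v =
      (inner ℝ u v - inner ℝ (J u) (J v) - c * inner ℝ (M q (J u)) (J v) : ℝ) := by
  have h : formOp J M c q u = u - ContinuousLinearMap.adjoint J (J u) -
      c • ContinuousLinearMap.adjoint J (M q (J u)) := rfl
  rw [h, inner_sub_left, inner_sub_left, real_inner_smul_left,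
    ContinuousLinearMap.adjoint_inner_left, ContinuousLinearMap.adjoint_inner_left]

theorem isSelfAdjoint_formOp (J : H →L[ℝ] Y) {M : Q →L[ℝ] Y →L[ℝ] Y}
    (hM : ∀ q f g, inner ℝ (M q f) g = (inner ℝ f (M q g) : ℝ)) (c : ℝ) (q : Q) :
    IsSelfAdjoint (formOp J M c q) := by
  rw [ContinuousLinearMap.isSelfAdjoint_iff_isSymmetric]
  intro u v
  change inner ℝ (formOp J M c q u) v = (inner ℝ u (formOp J M c q v) : ℝ)
  rw [real_inner_comm _ u, inner_formOp, inner_formOp, hM, real_inner_comm u v,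
    real_inner_comm (J u) (J v), real_inner_comm (M q (J v)) (J u)]

/-- The dependence on `q` is affine, so the derivative is the linear part at every point. -/
theorem hasFDerivAt_formOp (J : H →L[ℝ] Y) (M : Q →L[ℝ] Y →L[ℝ] Y) (c : ℝ) (q : Q) :
    HasFDerivAt (formOp J M c)
      (-(c • (sandwichCLM (ContinuousLinearMap.adjoint J) J).comp M)) q :=
  ((c • (sandwichCLM (ContinuousLinearMap.adjoint J) J).comp M).hasFDerivAt (x := q)).const_sub
    (1 - (ContinuousLinearMap.adjoint J).comp J)

/-- The solution operator `g ↦ u` of the problem `formOp q u = τ* g`. -/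
noncomputable def formSolution (J : H →L[ℝ] Y) (M : Q →L[ℝ] Y →L[ℝ] Y) (τ : H →L[ℝ] B) (c : ℝ)
    (q : Q) : B →L[ℝ] H :=
  (Ring.inverse (formOp J M c q)).comp (ContinuousLinearMap.adjoint τ)

theorem isOpen_isUnit_formOp (J : H →L[ℝ] Y) (M : Q →L[ℝ] Y →L[ℝ] Y) (c : ℝ) :
    IsOpen {q | IsUnit (formOp J M c q)} :=
  Units.isOpen.preimage
    (continuous_iff_continuousAt.mpr fun q => (hasFDerivAt_formOp J M c q).continuousAt)

theorem eq_formSolution_iff {J : H →L[ℝ] Y} {M : Q →L[ℝ] Y →L[ℝ] Y} {τ : H →L[ℝ] B} {c : ℝ}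
    {q : Q} (hq : IsUnit (formOp J M c q)) {g : B} {u : H} :
    (∀ v, inner ℝ u v - inner ℝ (J u) (J v) - c * inner ℝ (M q (J u)) (J v) =
      (inner ℝ g (τ v) : ℝ)) ↔ u = formSolution J M τ c q g := by
  have h1 : (∀ v, inner ℝ u v - inner ℝ (J u) (J v) - c * inner ℝ (M q (J u)) (J v) =
      (inner ℝ g (τ v) : ℝ)) ↔ formOp J M c q u = ContinuousLinearMap.adjoint τ g := by
    constructor
    · intro h
      refine ext_inner_right ℝ fun v => ?_
      rw [inner_formOp, ContinuousLinearMap.adjoint_inner_left]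
      exact h v
    · intro h v
      rw [← inner_formOp, h, ContinuousLinearMap.adjoint_inner_left]
  rw [h1]
  constructor
  · intro h
    have h2 : Ring.inverse (formOp J M c q) (formOp J M c q u) = u :=
      DFunLike.congr_fun (Ring.inverse_mul_cancel _ hq) u
    rw [← h2, h]
    rfl
  · rintro rfl
    exact DFunLike.congr_fun (Ring.mul_inverse_cancel _ hq) (ContinuousLinearMap.adjoint τ g)

/-- Both subtracted terms factor through `J`: they are J* S J with S = 1 + c M(q), which is the
shape the Fredholm alternative requires. -/
theorem isUnit_formOp_of_injective [TopologicalSpace.SeparableSpace H] (J : H →L[ℝ] Y)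
    (hJ : ∀ (u : ℕ → H) (M : ℝ), (∀ m, ‖u m‖ ≤ M) →
      (∀ v, Tendsto (fun m => inner ℝ v (u m)) atTop (𝓝 (0 : ℝ))) →
      Tendsto (fun m => J (u m)) atTop (𝓝 0))
    {M : Q →L[ℝ] Y →L[ℝ] Y} (hM : ∀ q f g, inner ℝ (M q f) g = (inner ℝ f (M q g) : ℝ)) {c : ℝ}
    {q : Q}
    (hinj : ∀ u, (∀ v, inner ℝ u v - inner ℝ (J u) (J v) - c * inner ℝ (M q (J u)) (J v) =
      (0 : ℝ)) → u = 0) :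
    IsUnit (formOp J M c q) := by
  refine isUnit_one_sub_of_injective J hJ (1 + c • M q) (fun u v => ?_)
    (isSelfAdjoint_formOp J hM c q) fun u hu => hinj u fun v => ?_
  · have h : (1 + c • M q) (J u) = J u + c • M q (J u) := rfl
    rw [inner_formOp, h, inner_add_left, real_inner_smul_left]
    ring
  · rw [← inner_formOp, hu, inner_zero_left]

/-- Chain rule with d(A⁻¹) = -A⁻¹ (dA) A⁻¹. The sign cancels the one in dA = -c J* M(·) J. -/
theorem hasFDerivAt_comp_formSolution (J : H →L[ℝ] Y) (M : Q →L[ℝ] Y →L[ℝ] Y) (τ : H →L[ℝ] B)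
    (c : ℝ) {q : Q} (hq : IsUnit (formOp J M c q)) :
    HasFDerivAt (fun q => τ.comp (formSolution J M τ c q))
      ((sandwichCLM (τ.comp (Ring.inverse (formOp J M c q))) (formSolution J M τ c q)).comp
        (c • (sandwichCLM (ContinuousLinearMap.adjoint J) J).comp M)) q := by
  obtain ⟨U, hU⟩ := hq
  have h1 : HasFDerivAt Ring.inverse
      (-((ContinuousLinearMap.mulLeftRight ℝ (H →L[ℝ] H)) ↑U⁻¹) ↑U⁻¹) (formOp J M c q) :=
    hU ▸ hasFDerivAt_ringInverse (𝕜 := ℝ) U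
  have h2 := h1.comp q (hasFDerivAt_formOp J M c q)
  have h3 := (sandwichCLM τ (ContinuousLinearMap.adjoint τ)).hasFDerivAt.comp q h2
  refine h3.congr_fderiv ?_
  have hinv : Ring.inverse (formOp J M c q) = ↑U⁻¹ := by rw [← hU, Ring.inverse_unit]
  rw [formSolution, hinv]
  ext1 h
  refine ContinuousLinearMap.ext fun g => ?_
  simp [sandwichCLM_apply, ContinuousLinearMap.mulLeftRight_apply]

/-- Moving τ and the self-adjoint A⁻¹ to the other argument turns the second vector into a solution
as well, so the form becomes c⟨M(h)Ju, Ju'⟩, symmetric in the data. Agreement of `N` with τ A⁻¹ τ*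
is required only near `q`, since away from its domain the Neumann-to-Dirichlet map may take a
default value. -/
theorem inner_fderiv_comp_formSolution (J : H →L[ℝ] Y) {M : Q →L[ℝ] Y →L[ℝ] Y}
    (hM : ∀ q f g, inner ℝ (M q f) g = (inner ℝ f (M q g) : ℝ)) (τ : H →L[ℝ] B) (c : ℝ) {q : Q}
    (hq : IsUnit (formOp J M c q)) {N : Q → B →L[ℝ] B}
    (hN : N =ᶠ[𝓝 q] fun q => τ.comp (formSolution J M τ c q)) :
    DifferentiableAt ℝ N q ∧ ∀ h : Q, IsSelfAdjoint (fderiv ℝ N q h) ∧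
      ∀ g, inner ℝ (fderiv ℝ N q h g) g = (c * inner ℝ (M h (J (formSolution J M τ c q g)))
        (J (formSolution J M τ c q g)) : ℝ) := by
  have hd := (hasFDerivAt_comp_formSolution J M τ c hq).congr_of_eventuallyEq hN
  have hinv : IsSelfAdjoint (Ring.inverse (formOp J M c q)) := by
    obtain ⟨U, hU⟩ := hq
    have hUs : star U = U := Units.ext (by
      rw [Units.coe_star, hU, (isSelfAdjoint_formOp J hM c q).star_eq])
    rw [IsSelfAdjoint, ← hU, Ring.inverse_unit, ← Units.coe_star, star_inv, hUs]
  have hsym : ∀ x y, inner ℝ (Ring.inverse (formOp J M c q) x) y =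
      (inner ℝ x (Ring.inverse (formOp J M c q) y) : ℝ) :=
    ContinuousLinearMap.isSelfAdjoint_iff_isSymmetric.mp hinv
  -- The full bilinear form is computed, not just its diagonal, because self-adjointness is read off
  -- from it.
  have hform : ∀ h g g', inner ℝ (fderiv ℝ N q h g) g' =
      (c * inner ℝ (M h (J (formSolution J M τ c q g))) (J (formSolution J M τ c q g')) : ℝ) := by
    intro h g g'
    have he : fderiv ℝ N q h g = τ (Ring.inverse (formOp J M c q)
        (c • ContinuousLinearMap.adjoint J (M h (J (formSolution J M τ c q g))))) := by
      rw [hd.fderiv]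
      rfl
    rw [he, ← ContinuousLinearMap.adjoint_inner_right, hsym, real_inner_smul_left,
      ContinuousLinearMap.adjoint_inner_left]
    rfl
  refine ⟨hd.differentiableAt, fun h => ⟨?_, fun g => hform h g g⟩⟩
  rw [ContinuousLinearMap.isSelfAdjoint_iff_isSymmetric]
  intro g g'
  change inner ℝ (fderiv ℝ N q h g) g' = (inner ℝ g (fderiv ℝ N q h g') : ℝ)
  rw [real_inner_comm _ g, hform, hform, hM, real_inner_comm]

end Hilbert

/-! ### The Neumann problem as an instance -/

section Neumann

variable {n : ℕ} {Ω : Set (EuclideanSpace ℝ (Fin n))}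

/-- Multiplication operators on `L²(Ω)` by functions in `L^∞(Ω)`. -/
noncomputable def multiplicationOp (Ω : Set (EuclideanSpace ℝ (Fin n))) :
    DomainLinfty Ω →L[ℝ] (Lp ℝ 2 (volume.restrict Ω) →L[ℝ] Lp ℝ 2 (volume.restrict Ω)) :=
  (ContinuousLinearMap.mul ℝ ℝ).holderL (volume.restrict Ω) ⊤ 2 2

theorem multiplicationOp_ae (q : DomainLinfty Ω) (f : Lp ℝ 2 (volume.restrict Ω)) :
    multiplicationOp Ω q f =ᵐ[volume.restrict Ω] fun x => q x * f x :=
  (ContinuousLinearMap.mul ℝ ℝ).coeFn_holder (r := 2) q f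

theorem inner_multiplicationOp (q : DomainLinfty Ω) (f g : Lp ℝ 2 (volume.restrict Ω)) :
    inner ℝ (multiplicationOp Ω q f) g = ∫ x in Ω, q x * f x * g x := by
  rw [L2.inner_def]
  apply integral_congr_ae
  filter_upwards [multiplicationOp_ae q f] with x hx
  rw [hx, real_inner_comm]
  rfl

theorem inner_multiplicationOp_comm (q : DomainLinfty Ω) (f g : Lp ℝ 2 (volume.restrict Ω)) :
    inner ℝ (multiplicationOp Ω q f) g = (inner ℝ f (multiplicationOp Ω q g) : ℝ) := by
  rw [real_inner_comm (multiplicationOp Ω q g) f, inner_multiplicationOp, inner_multiplicationOp]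
  congr 1 with x
  ring

theorem inner_sobolevH1 (u v : sobolevH1 Ω) :
    inner ℝ u v = (inner ℝ (sobolevVal u) (sobolevVal v) +
      inner ℝ (sobolevGrad u) (sobolevGrad v) : ℝ) :=
  WithLp.prod_inner_apply _ _

theorem integral_inner_sub_eq (c : ℝ) (q : DomainLinfty Ω) (f g : Lp ℝ 2 (volume.restrict Ω))
    (F G : Lp (EuclideanSpace ℝ (Fin n)) 2 (volume.restrict Ω)) :
    ∫ x in Ω, (inner ℝ (F x) (G x) - c * q x * f x * g x) =
      inner ℝ F G - c * inner ℝ (multiplicationOp Ω q f) g := by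
  have h1 : Integrable (fun x => (inner ℝ (F x) (G x) : ℝ)) (volume.restrict Ω) :=
    L2.integrable_inner F G
  have h2 : Integrable (fun x => c * q x * f x * g x) (volume.restrict Ω) := by
    have h := (L2.integrable_inner (𝕜 := ℝ) (multiplicationOp Ω q f) g).const_mul c
    refine h.congr ?_
    filter_upwards [multiplicationOp_ae q f] with x hx
    rw [hx]
    change c * (g x * (q x * f x)) = _
    ring
  have h3 : ∫ x in Ω, c * q x * f x * g x = c * ∫ x in Ω, q x * f x * g x := by
    rw [← integral_const_mul]
    congr 1 with x
    ring
  rw [integral_sub h1 h2, inner_multiplicationOp, h3, L2.inner_def F]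

/-- The bilinear form of the Neumann problem in terms of inner products. -/
theorem integral_neumannForm_eq (k : ℝ) (q : DomainLinfty Ω) (u v : sobolevH1 Ω) :
    ∫ x in Ω, (inner ℝ (sobolevGrad u x) (sobolevGrad v x)
      - k ^ 2 * q x * sobolevVal u x * sobolevVal v x) =
    inner ℝ u v - inner ℝ (sobolevEmbedding Ω u) (sobolevEmbedding Ω v) -
      k ^ 2 * inner ℝ (multiplicationOp Ω q (sobolevEmbedding Ω u)) (sobolevEmbedding Ω v) := by
  have h1 := integral_inner_sub_eq (k ^ 2) q (sobolevVal u) (sobolevVal v) (sobolevGrad u)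
    (sobolevGrad v)
  have h2 := inner_sobolevH1 u v
  simp only [sobolevEmbedding_apply]
  linarith

theorem inner_boundaryL2 (f g : BoundaryL2 Ω) :
    inner ℝ f g = ∫ x, f x * g x ∂(surfaceMeasure Ω) := by
  rw [L2.inner_def]
  congr 1 with x
  exact mul_comm _ _

/-- Traces exist and are unique, so quantifying over all pairs (v, trace of v) is the same as
quantifying over `v` alone. -/
theorem isNeumannSolution_iff (hΩ : IsBoundedLipschitzDomain Ω) (k : ℝ) (q : DomainLinfty Ω)
    (g : BoundaryL2 Ω) (u : sobolevH1 Ω) :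
    IsNeumannSolution Ω k q g u ↔ ∀ v,
      inner ℝ u v - inner ℝ (sobolevEmbedding Ω u) (sobolevEmbedding Ω v) -
        k ^ 2 * inner ℝ (multiplicationOp Ω q (sobolevEmbedding Ω u)) (sobolevEmbedding Ω v) =
      (inner ℝ g (traceOp hΩ v) : ℝ) := by
  constructor
  · intro h v
    rw [← integral_neumannForm_eq, inner_boundaryL2]
    exact h v _ ((isTrace_iff_eq_traceOp hΩ).mpr rfl)
  · intro h v tv htv
    rw [(isTrace_iff_eq_traceOp hΩ).mp htv, integral_neumannForm_eq, h v, inner_boundaryL2]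

/-- The operator of the Neumann problem on `H¹(Ω)`. -/
noncomputable abbrev neumannOp (Ω : Set (EuclideanSpace ℝ (Fin n))) (k : ℝ) (q : DomainLinfty Ω) :
    sobolevH1 Ω →L[ℝ] sobolevH1 Ω :=
  formOp (sobolevEmbedding Ω) (multiplicationOp Ω) (k ^ 2) q

/-- The solution operator `g ↦ u` of the Neumann problem. -/
noncomputable abbrev neumannSolution (hΩ : IsBoundedLipschitzDomain Ω) (k : ℝ)
    (q : DomainLinfty Ω) : BoundaryL2 Ω →L[ℝ] sobolevH1 Ω :=
  formSolution (sobolevEmbedding Ω) (multiplicationOp Ω) (traceOp hΩ) (k ^ 2) q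

theorem isNeumannSolution_iff_eq (hΩ : IsBoundedLipschitzDomain Ω) {k : ℝ} {q : DomainLinfty Ω}
    (hq : IsUnit (neumannOp Ω k q)) (g : BoundaryL2 Ω) (u : sobolevH1 Ω) :
    IsNeumannSolution Ω k q g u ↔ u = neumannSolution hΩ k q g :=
  (isNeumannSolution_iff hΩ k q g u).trans (eq_formSolution_iff hq)

/-- Absence of resonance is injectivity of the Neumann operator; Rellich's theorem and the Fredholm
alternative upgrade it to invertibility. -/
theorem mem_ntdDomain_iff (hΩ : IsBoundedLipschitzDomain Ω) (k : ℝ) (q : DomainLinfty Ω) :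
    q ∈ ntdDomain Ω k ↔ IsUnit (neumannOp Ω k q) := by
  have h : q ∈ ntdDomain Ω k ↔ ∀ u, IsNeumannSolution Ω k q 0 u → u = 0 := by
    simp only [ntdDomain, resonanceSet, Set.mem_compl_iff, Set.mem_ofPred_eq, not_exists, not_and',
      not_not, ne_eq]
  rw [h]
  constructor
  · intro hinj
    refine isUnit_formOp_of_injective (sobolevEmbedding Ω)
      (fun u M hM hu => hΩ.tendsto_sobolevEmbedding hM hu) inner_multiplicationOp_comm
      fun u hu => hinj u ((isNeumannSolution_iff hΩ k q 0 u).mpr fun v => ?_)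
    rw [hu, inner_zero_left]
  · intro hunit u hu
    rw [(isNeumannSolution_iff_eq hΩ hunit 0 u).mp hu, map_zero]

/-- Uniqueness of solutions and of traces leaves exactly one operator satisfying `IsNtD`, so the
choice in the definition of `ntd` is forced. -/
theorem ntd_eq (hΩ : IsBoundedLipschitzDomain Ω) {k : ℝ} {q : DomainLinfty Ω}
    (hq : IsUnit (neumannOp Ω k q)) :
    ntd Ω k q = (traceOp hΩ).comp (neumannSolution hΩ k q) := by
  have hiff : ∀ T, IsNtD Ω k q T ↔ T = (traceOp hΩ).comp (neumannSolution hΩ k q) := by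
    intro T
    simp only [IsNtD, isNeumannSolution_iff_eq hΩ hq, isTrace_iff_eq_traceOp hΩ, exists_eq_left]
    exact ⟨fun h => ContinuousLinearMap.ext h, fun h g => h ▸ rfl⟩
  have hex : ∃ T, IsNtD Ω k q T := ⟨_, (hiff _).mpr rfl⟩
  rw [ntd, dif_pos hex]
  exact (hiff _).mp hex.choose_spec

end Neumann

/-! ### Conclusion -/

theorem lemma2p2 {n : ℕ} (hn : 2 ≤ n) (Ω : Set (EuclideanSpace ℝ (Fin n)))
    (hΩ : IsBoundedLipschitzDomain Ω) (k : ℝ) (hk : 0 < k) :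
    IsOpen (ntdDomain Ω k) ∧
    ∀ q ∈ ntdDomain Ω k,
      (∀ g : BoundaryL2 Ω, ∃ u : sobolevH1 Ω, IsNeumannSolution Ω k q g u ∧
        (∀ w : sobolevH1 Ω, IsNeumannSolution Ω k q g w → w = u) ∧
        ∀ f : BoundaryL2 Ω, IsTrace u f ↔ f = ntd Ω k q g) ∧
      DifferentiableAt ℝ (ntd Ω k) q ∧
      ∀ h : DomainLinfty Ω,
        IsSelfAdjoint (fderiv ℝ (ntd Ω k) q h) ∧
        ∀ (g : BoundaryL2 Ω) (u : sobolevH1 Ω), IsNeumannSolution Ω k q g u →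
          ∫ x, g x * (fderiv ℝ (ntd Ω k) q h g) x ∂(surfaceMeasure Ω)
            = ∫ x in Ω, k ^ 2 * h x * |sobolevVal u x| ^ 2 := by
  have hdom : ntdDomain Ω k = {q | IsUnit (neumannOp Ω k q)} :=
    Set.ext fun q => mem_ntdDomain_iff hΩ k q
  have hopen : IsOpen {q | IsUnit (neumannOp Ω k q)} := isOpen_isUnit_formOp _ _ _
  rw [hdom]
  refine ⟨hopen, fun q hq => ?_⟩
  replace hq : IsUnit (neumannOp Ω k q) := hq
  -- Openness of the domain gives the formula τ A⁻¹ τ* on a neighbourhood of `q`, so the default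
  -- value of `ntd` elsewhere does not affect the derivative.
  have hN : ntd Ω k =ᶠ[𝓝 q] fun q => (traceOp hΩ).comp (neumannSolution hΩ k q) := by
    filter_upwards [hopen.mem_nhds hq] with p hp using ntd_eq hΩ hp
  obtain ⟨hdiff, hderiv⟩ := inner_fderiv_comp_formSolution (sobolevEmbedding Ω)
    inner_multiplicationOp_comm (traceOp hΩ) (k ^ 2) hq hN
  refine ⟨fun g => ⟨neumannSolution hΩ k q g, (isNeumannSolution_iff_eq hΩ hq g _).mpr rfl,
    fun w hw => (isNeumannSolution_iff_eq hΩ hq g w).mp hw, fun f => ?_⟩, hdiff,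
    fun h => ⟨(hderiv h).1, fun g u hu => ?_⟩⟩
  · rw [isTrace_iff_eq_traceOp hΩ, ntd_eq hΩ hq]
    rfl
  · calc ∫ x, g x * (fderiv ℝ (ntd Ω k) q h g) x ∂(surfaceMeasure Ω)
        = inner ℝ g (fderiv ℝ (ntd Ω k) q h g) := (inner_boundaryL2 _ _).symm
      _ = inner ℝ (fderiv ℝ (ntd Ω k) q h g) g := real_inner_comm _ _
      _ = k ^ 2 * inner ℝ (multiplicationOp Ω h (sobolevVal u)) (sobolevVal u) := by
          rw [(isNeumannSolution_iff_eq hΩ hq g u).mp hu]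
          exact (hderiv h).2 g
      _ = _ := by
          rw [inner_multiplicationOp, ← integral_const_mul]
          congr 1 with x
          rw [sq_abs]
          ring
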